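/- Let $N\ge 1$, let $\lambda_1,\dots,\lambda_N>0$, and let $G_1,\dots,G_N$ be probability distributions on $[0,\infty)$ with finite means $x_1,\dots,x_N$. Consider the multi-class M/G/1/1 system: for each $n$, class-$n$ packets are generated and arrive at a single server at the points $T_{n,1}<T_{n,2}<\cdots$ of a Poisson process on $(0,\infty)$ of rate $\lambda_n$, and the $i$-th class-$n$ packet requires a service time $S_{n,i}$ with distribution $G_n$; the $N$ Poisson processes and all service times are mutually independent. The server is idle at time $0$ and there is no buffer: a packet that finds the server idle on arrival is admitted, enters service at once and is received when its service is completed; a packet that finds the server busy is discarded. The status age $\Delta_n(t)$ of class $n$ is $t$ minus the generation time of the latest class-$n$ packet received up to time $t$ (before the first reception, $\Delta_n(t)=a_n+t$ with a given initial age $a_n\ge 0$). Let $A_{nk}$ be the $k$-th peak of $\Delta_n$, that is, the value of $\Delta_n$ immediately before the $k$-th reception of a class-$n$ packet. Then, almost surely, the set of admitted packets is uniquely determined, and for every class $n$ infinitely many class-$n$ packets are received and the peak age-of-information of class $n$ exists and equals $$A_{p,n}=\lim_{K\to\infty}\frac1K\sum_{k=1}^K A_{nk}=x_n+\frac1{\lambda_n}+\frac{\sum_{k=1}^N\lambda_k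 x_k}{\lambda_n}.$$ No stability condition (such as $\sum_k\lambda_kx_k<1$) and no finiteness of second moments is assumed. -/

import Mathlib

open MeasureTheory ProbabilityTheory Filter Topology

/-! One realization of a multi-class loss system with a single server and no buffer.
Packets are labelled by pairs `(n, i)`: the `i`-th packet (`i = 0, 1, …`) of class `n : Fin N`.
`T n i` is its generation (arrival) time and `S n i` is the service time it requires. -/

namespace MG11

noncomputable section

/-- The arrival times of a renewal stream with inter-arrival times `τ 0, τ 1, …`, started at time
`0`. If the `τ i` are i.i.d. exponential of rate `r`, this is the Poisson process of rate `r`. -/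
def arrivalTime (τ : ℕ → ℝ) (i : ℕ) : ℝ := ∑ j ∈ Finset.range (i + 1), τ j

/-- `Adm` is the set of admitted packets: a packet is admitted if and only if it does not find the
server busy on arrival, i.e. every previously admitted packet has already left. All other packets
are discarded. The server is idle at time `0`. -/
def IsAdmitted {N : ℕ} (T S : Fin N → ℕ → ℝ) (Adm : Set (Fin N × ℕ)) : Prop :=
  ∀ p : Fin N × ℕ, p ∈ Adm ↔
    ∀ q ∈ Adm, T q.1 q.2 < T p.1 p.2 → T q.1 q.2 + S q.1 q.2 ≤ T p.1 p.2

/-- The generation time of the latest class-`n` packet received (i.e. completely served) up to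
time `t`. The information held about class `n` at time `0` has age `a₀`. -/
def lastGeneration {N : ℕ} (T S : Fin N → ℕ → ℝ) (Adm : Set (Fin N × ℕ)) (a₀ : ℝ)
    (n : Fin N) (t : ℝ) : ℝ :=
  sSup (insert (-a₀) {u | ∃ i, (n, i) ∈ Adm ∧ T n i + S n i ≤ t ∧ u = T n i})

/-- The status age `Δ_n(t)`: the time elapsed since the latest received class-`n` packet was
generated. -/
def age {N : ℕ} (T S : Fin N → ℕ → ℝ) (Adm : Set (Fin N × ℕ)) (a₀ : ℝ)
    (n : Fin N) (t : ℝ) : ℝ :=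
  t - lastGeneration T S Adm a₀ n t

/-- The time at which the `k`-th (`k = 0, 1, …`) admitted class-`n` packet completes service.
(Admitted packets are served in the order of their arrival.) -/
def receptionTime {N : ℕ} (T S : Fin N → ℕ → ℝ) (Adm : Set (Fin N × ℕ))
    (n : Fin N) (k : ℕ) : ℝ :=
  T n (Nat.nth (fun i => (n, i) ∈ Adm) k) + S n (Nat.nth (fun i => (n, i) ∈ Adm) k)

/-- The `k`-th peak of the status age of class `n`: the value of `Δ_n` just before it drops at the
`k`-th reception of a class-`n` packet. -/
def peakAge {N : ℕ} (T S : Fin N → ℕ → ℝ) (Adm : Set (Fin N × ℕ)) (a₀ : ℝ)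
    (n : Fin N) (k : ℕ) : ℝ :=
  Function.leftLim (age T S Adm a₀ n) (receptionTime T S Adm n k)

/-- `a` is the peak age-of-information of class `n`: there are infinitely many receptions (hence
peaks) of class `n`, and the long-run average of the peaks exists and equals `a`. -/
def HasPAoI {N : ℕ} (T S : Fin N → ℕ → ℝ) (Adm : Set (Fin N × ℕ)) (a₀ : ℝ)
    (n : Fin N) (a : ℝ) : Prop :=
  {i : ℕ | (n, i) ∈ Adm}.Infinite ∧
    Tendsto (fun K : ℕ => (1 / (K : ℝ)) * ∑ k ∈ Finset.range K, peakAge T S Adm a₀ n k)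
      atTop (𝓝 a)

end

end MG11

/-! Write Λ for the sum of the rates. The system regenerates whenever the server becomes idle. By
memorylessness, the inputs seen from the departure of the first packet on are again independent
marked Poisson processes with the original joint law, independent of that packet
(`systemLaw_firstPacket_inter_nextInput`). The first packet has class n with probability λ_n/Λ,
arrives after an exponential time of rate Λ independent of its class, and, given class n, has an
independent service time of law G_n.

Hence `nextInput` preserves `systemLaw`, and the packets read off along its iterates are identically
distributed and pairwise independent. The strong law gives the long-run averages over admitted
packets (`tendsto_average_firstPacket`): frequency λ_n/Λ of class n, mean idle period 1/Λ, mean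
service time (∑ λ_k x_k)/Λ, and class-n service per admitted packet λ_n x_n/Λ. Only first moments
enter. Since blocked packets are lost, no load condition is needed.

The rest is pathwise. If T_k, S_k and D_k = T_k + S_k are the arrival, service and reception times
of the k-th admitted class-n packet, the peak at D_{k+1} is D_{k+1} - T_k = (D_{k+1} - D_k) + S_k.
The peaks therefore sum to D_K plus earlier class-n service times plus the initial age
(`sum_peakAge`). As D_K is the end of a busy period, it is a sum of idle periods and services.
Dividing by the number of class-n packets gives (1 + ∑ λ_k x_k)/λ_n + x_n (`hasPAoI_of_averages`).

Two links remain. On a realization without coincidences the iterates of `nextInput` really produce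
the admitted packets (`IsRegular.isAdmissionSeq`), and almost every realization is of this kind
(`ae_isRegularInput`). -/

namespace MG11

noncomputable section

open scoped ENNReal

/-- A packet stream of one class: the pairs (inter-arrival time, service time). -/
abbrev PacketStream := ℕ → ℝ × ℝ

/-! ### Deterministic calculus of streams: shifting the origin of time and prepending a packet. -/

namespace PacketStream

/-- The arrival time of the `i`-th packet of a stream. -/
def arrival (w : PacketStream) (i : ℕ) : ℝ := arrivalTime (fun j => (w j).1) i

/-- The index of the first packet that arrives strictly after time `r`. -/
def firstAfter (r : ℝ) (w : PacketStream) : ℕ := sInf {i | r < w.arrival i}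

/-- The stream seen by an observer who starts watching at time `r`. -/
def shift (r : ℝ) (w : PacketStream) : PacketStream := fun i =>
  (if i = 0 then w.arrival (firstAfter r w) - r else (w (firstAfter r w + i)).1,
    (w (firstAfter r w + i)).2)

/-- Prepend a packet to a stream. -/
def cons (z : ℝ × ℝ) (w : PacketStream) : PacketStream
  | 0 => z
  | i + 1 => w i

/-- The arrival times of the stream are unbounded. -/
def Unbounded (w : PacketStream) : Prop := ∀ r, ∃ i, r < w.arrival i

@[simp] lemma cons_zero (z : ℝ × ℝ) (w : PacketStream) : cons z w 0 = z := rfl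

@[simp] lemma cons_succ (z : ℝ × ℝ) (w : PacketStream) (i : ℕ) : cons z w (i + 1) = w i := rfl

lemma arrival_zero (w : PacketStream) : w.arrival 0 = (w 0).1 := by
  simp [arrival, arrivalTime]

lemma arrival_succ (w : PacketStream) (i : ℕ) :
    w.arrival (i + 1) = w.arrival i + (w (i + 1)).1 := by
  simp only [arrival, arrivalTime]
  rw [Finset.sum_range_succ]

lemma strictMono_arrival {w : PacketStream} (hw : ∀ i, 0 < (w i).1) : StrictMono w.arrival :=
  strictMono_nat_of_lt_succ fun i => by rw [arrival_succ]; linarith [hw (i + 1)]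

lemma arrival_cons_succ (z : ℝ × ℝ) (w : PacketStream) (i : ℕ) :
    (cons z w).arrival (i + 1) = z.1 + w.arrival i := by
  induction i with
  | zero => rw [arrival_succ, arrival_zero, arrival_zero]; simp
  | succ i ih => rw [arrival_succ, ih, arrival_succ]; simp [add_assoc]

lemma arrival_cons_sub (a b t : ℝ) (w : PacketStream) (i : ℕ) :
    (cons (a - t, b) w).arrival i = (cons (a, b) w).arrival i - t := by
  cases i with
  | zero => simp [arrival_zero]
  | succ i => rw [arrival_cons_succ, arrival_cons_succ]; simp only; ring

lemma firstAfter_eq_of {r : ℝ} {w : PacketStream} {j : ℕ} (hj : r < w.arrival j)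
    (hlt : ∀ i < j, w.arrival i ≤ r) : firstAfter r w = j := by
  refine le_antisymm (Nat.sInf_le hj) (le_csInf ⟨j, hj⟩ fun i hi => ?_)
  by_contra! h
  exact absurd (hlt i h) (not_le.2 hi)

lemma Unbounded.lt_arrival_firstAfter {w : PacketStream} (hw : w.Unbounded) (r : ℝ) :
    r < w.arrival (firstAfter r w) := Nat.sInf_mem (hw r)

lemma arrival_le_of_lt_firstAfter {w : PacketStream} {r : ℝ} {i : ℕ} (hi : i < firstAfter r w) :
    w.arrival i ≤ r := not_lt.1 (Nat.notMem_of_lt_sInf hi)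

lemma arrival_shift (r : ℝ) (w : PacketStream) (i : ℕ) :
    (shift r w).arrival i = w.arrival (firstAfter r w + i) - r := by
  induction i with
  | zero => simp [arrival_zero, shift]
  | succ i ih => rw [arrival_succ, ih, ← add_assoc, arrival_succ]; simp [shift, add_assoc]; ring

lemma shift_snd (r : ℝ) (w : PacketStream) (i : ℕ) :
    (shift r w i).2 = (w (firstAfter r w + i)).2 := rfl

lemma eq_of_arrival_eq {v w : PacketStream} (h₁ : ∀ i, v.arrival i = w.arrival i)
    (h₂ : ∀ i, (v i).2 = (w i).2) : v = w := by
  funext i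
  refine Prod.ext ?_ (h₂ i)
  cases i with
  | zero => rw [← arrival_zero, ← arrival_zero, h₁]
  | succ i =>
    have := h₁ (i + 1)
    rw [arrival_succ, arrival_succ, h₁ i] at this
    linarith

/-- Watching from time `b` on, after having started at time `a`, is watching from `a + b` on. -/
lemma shift_shift {w : PacketStream} (hw : w.Unbounded) {a b : ℝ}
    (hb : 0 ≤ b) : shift b (shift a w) = shift (a + b) w := by
  have hle : firstAfter a w ≤ firstAfter (a + b) w := by
    by_contra! h
    have h₁ := arrival_le_of_lt_firstAfter h
    have h₂ := hw.lt_arrival_firstAfter (a + b)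
    linarith
  have key : firstAfter a w + firstAfter b (shift a w) = firstAfter (a + b) w := by
    have : firstAfter b (shift a w) = firstAfter (a + b) w - firstAfter a w := by
      apply firstAfter_eq_of
      · rw [arrival_shift, Nat.add_sub_cancel' hle]
        linarith [hw.lt_arrival_firstAfter (a + b)]
      · intro i hi
        rw [arrival_shift]
        linarith [arrival_le_of_lt_firstAfter (w := w) (r := a + b) (i := firstAfter a w + i)
          (by omega)]
    omega
  apply eq_of_arrival_eq
  · intro i
    rw [arrival_shift, arrival_shift, arrival_shift, ← add_assoc, key]
    ring
  · intro i
    rw [shift_snd, shift_snd, shift_snd, ← add_assoc, key]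

/-- This and `shift_cons_of_le` are the two cases of a renewal argument. An observer who starts
before the first arrival sees only a shortened first waiting time. One who starts later has lost the
first packet and watches the remaining stream from time `r - a`. -/
lemma shift_cons_of_lt {a b r : ℝ} (h : r < a) (w : PacketStream) :
    shift r (cons (a, b) w) = cons (a - r, b) w := by
  have hJ : firstAfter r (cons (a, b) w) = 0 :=
    firstAfter_eq_of (by simpa [arrival_zero] using h) (by simp)
  apply eq_of_arrival_eq
  · intro i
    rw [arrival_shift, hJ, zero_add, arrival_cons_sub]
  · intro i
    rw [shift_snd, hJ, zero_add]
    cases i <;> rfl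

lemma shift_add_cons (a b t s : ℝ) (w : PacketStream) :
    shift (t + s) (cons (a, b) w) = shift s (cons (a - t, b) w) := by
  have hJ : firstAfter (t + s) (cons (a, b) w) = firstAfter s (cons (a - t, b) w) := by
    simp only [firstAfter, arrival_cons_sub, lt_sub_iff_add_lt']
  apply eq_of_arrival_eq
  · intro i
    rw [arrival_shift, arrival_shift, hJ, arrival_cons_sub]
    ring
  · intro i
    rw [shift_snd, shift_snd, hJ]
    cases firstAfter s (cons (a - t, b) w) + i <;> rfl

lemma shift_cons_of_le {a b r : ℝ} (h : a ≤ r) {w : PacketStream} (hw : w.Unbounded) :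
    shift r (cons (a, b) w) = shift (r - a) w := by
  have hJ : firstAfter r (cons (a, b) w) = firstAfter (r - a) w + 1 := by
    apply firstAfter_eq_of
    · rw [arrival_cons_succ]
      simp only
      linarith [hw.lt_arrival_firstAfter (r - a)]
    · intro i hi
      cases i with
      | zero => simpa [arrival_zero] using h
      | succ i =>
        rw [arrival_cons_succ]
        simp only
        linarith [arrival_le_of_lt_firstAfter (Nat.lt_of_succ_lt_succ hi)]
  apply eq_of_arrival_eq
  · intro i
    rw [arrival_shift, arrival_shift, hJ, add_right_comm, arrival_cons_succ]
    simp only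
    ring
  · intro i
    rw [shift_snd, shift_snd, hJ, add_right_comm, cons_succ]

@[fun_prop]
lemma measurable_arrival (i : ℕ) : Measurable fun w : PacketStream => w.arrival i := by
  unfold arrival arrivalTime
  fun_prop

lemma measurable_firstAfter : Measurable fun p : ℝ × PacketStream => firstAfter p.1 p.2 := by
  classical
  have h : ∀ i : ℕ, MeasurableSet {p : ℝ × PacketStream | p.1 < p.2.arrival i} := fun i =>
    measurableSet_lt measurable_fst ((measurable_arrival i).comp measurable_snd)
  have hne : MeasurableSet {p : ℝ × PacketStream | ∃ i, p.1 < p.2.arrival i} := by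
    rw [Set.ofPred_exists]
    exact MeasurableSet.iUnion h
  -- The second alternative makes the search total: for a stream with no arrival after the given
  -- time it stops at 0, which is also the value of `sInf ∅`.
  have h2 : ∀ p : ℝ × PacketStream,
      ∃ i, p.1 < p.2.arrival i ∨ ¬ ∃ i, p.1 < p.2.arrival i := fun p => by
    by_cases hp : ∃ i, p.1 < p.2.arrival i
    · exact hp.imp fun i hi => Or.inl hi
    · exact ⟨0, Or.inr hp⟩
  have : (fun p : ℝ × PacketStream => firstAfter p.1 p.2) = fun p => Nat.find (h2 p) := by
    funext p
    symm
    rw [Nat.find_eq_iff]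
    by_cases hp : ∃ i, p.1 < p.2.arrival i
    · exact ⟨Or.inl (Nat.sInf_mem hp), fun i hi => by
        rintro (h | h)
        · exact absurd (arrival_le_of_lt_firstAfter hi) (not_le.2 h)
        · exact h hp⟩
    · refine ⟨Or.inr hp, fun i hi => ?_⟩
      have : firstAfter p.1 p.2 = 0 := by
        rw [firstAfter, Nat.sInf_eq_zero]
        right
        ext i
        simpa using not_lt.1 fun hi => hp ⟨i, hi⟩
      omega
  rw [this]
  exact measurable_find h2 fun i => (h i).union hne.compl

lemma measurable_shift : Measurable fun p : ℝ × PacketStream => shift p.1 p.2 := by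
  have heval : Measurable fun q : PacketStream × ℕ => q.1 q.2 :=
    measurable_from_prod_countable_left fun i => measurable_pi_apply i
  have harr : Measurable fun q : PacketStream × ℕ => q.1.arrival q.2 :=
    measurable_from_prod_countable_left fun i => measurable_arrival i
  refine measurable_pi_lambda _ fun i => ?_
  have h1 : Measurable fun p : ℝ × PacketStream => p.2 (firstAfter p.1 p.2 + i) :=
    heval.comp (measurable_snd.prodMk
      ((measurable_of_countable (fun j : ℕ => j + i)).comp measurable_firstAfter))
  refine Measurable.prodMk ?_ h1.snd
  by_cases hi : i = 0
  · simp only [hi, if_true]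
    exact (harr.comp (measurable_snd.prodMk measurable_firstAfter)).sub measurable_fst
  · simp only [hi, if_false]
    exact h1.fst

lemma _root_.Measurable.packetStream_shift {α : Type*} [MeasurableSpace α] {f : α → ℝ}
    {g : α → PacketStream} (hf : Measurable f) (hg : Measurable g) :
    Measurable fun a => shift (f a) (g a) := by
  have h : Measurable fun a => (f a, g a) := hf.prodMk hg
  exact measurable_shift.comp h

@[fun_prop]
lemma measurable_shift_const (r : ℝ) : Measurable (shift r) :=
  measurable_const.packetStream_shift measurable_id

@[fun_prop]
lemma measurable_cons : Measurable fun p : (ℝ × ℝ) × PacketStream => cons p.1 p.2 := by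
  refine measurable_pi_lambda _ fun i => ?_
  cases i with
  | zero => exact measurable_fst
  | succ i => exact (measurable_pi_apply i).comp measurable_snd

end PacketStream

/-! ### The exponential distribution: memorylessness, tilting and mean. -/

lemma measurable_exponentialPDF (r : ℝ) : Measurable (exponentialPDF r) :=
  (measurable_exponentialPDFReal r).ennreal_ofReal

lemma lintegral_expMeasure (r : ℝ) {f : ℝ → ℝ≥0∞} (hf : Measurable f) :
    ∫⁻ a, f a ∂expMeasure r = ∫⁻ a, exponentialPDF r a * f a :=
  lintegral_withDensity_eq_lintegral_mul _ (measurable_exponentialPDF r) hf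

instance nullSingletonClass_expMeasure (r : ℝ) : NullSingletonClass (expMeasure r) := by
  unfold expMeasure gammaMeasure
  infer_instance

lemma ae_pos_expMeasure (r : ℝ) : ∀ᵐ a ∂expMeasure r, 0 < a := by
  have h : expMeasure r (Set.Iio 0) = 0 := by
    change (volume.withDensity (exponentialPDF r)) (Set.Iio 0) = 0
    rw [withDensity_apply _ measurableSet_Iio]
    exact lintegral_exponentialPDF_of_nonpos le_rfl
  rw [ae_iff]
  simp only [not_lt]
  change expMeasure r (Set.Iic 0) = 0
  rw [measure_congr Iio_ae_eq_Iic.symm, h]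

lemma expMeasure_Iic {r : ℝ} (hr : 0 < r) {s : ℝ} (hs : 0 ≤ s) :
    expMeasure r (Set.Iic s) = ENNReal.ofReal (1 - Real.exp (-(r * s))) := by
  change (volume.withDensity (exponentialPDF r)) (Set.Iic s) = _
  rw [withDensity_apply _ measurableSet_Iic, lintegral_exponentialPDF_eq_antiDeriv hr, if_pos hs]

/-- The exponential distribution is memoryless. -/
lemma setLIntegral_Ioi_expMeasure (r : ℝ) {t : ℝ} (ht : 0 ≤ t) {f : ℝ → ℝ≥0∞}
    (hf : Measurable f) :
    ∫⁻ a in Set.Ioi t, f (a - t) ∂expMeasure r =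
      ENNReal.ofReal (Real.exp (-(r * t))) * ∫⁻ a, f a ∂expMeasure r := by
  have hg : Measurable fun u => exponentialPDF r u * f u := (measurable_exponentialPDF r).mul hf
  calc ∫⁻ a in Set.Ioi t, f (a - t) ∂expMeasure r
      = ∫⁻ a, (Set.Ioi t).indicator (fun a => f (a - t)) a ∂expMeasure r :=
        (lintegral_indicator measurableSet_Ioi _).symm
    _ = ∫⁻ a, exponentialPDF r a * (Set.Ioi t).indicator (fun a => f (a - t)) a :=
        lintegral_expMeasure r ((hf.comp (measurable_id.sub_const t)).indicator measurableSet_Ioi)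
    _ = ∫⁻ a, (Set.Ioi (0 : ℝ)).indicator (fun u => ENNReal.ofReal (Real.exp (-(r * t))) *
          (exponentialPDF r u * f u)) (a - t) := by
        refine lintegral_congr fun a => ?_
        by_cases h : t < a
        · rw [Set.indicator_of_mem (Set.mem_Ioi.2 h),
            Set.indicator_of_mem (Set.mem_Ioi.2 (sub_pos.2 h)),
            exponentialPDF_of_nonneg (ht.trans h.le), exponentialPDF_of_nonneg (sub_pos.2 h).le,
            ← mul_assoc, ← ENNReal.ofReal_mul (Real.exp_pos _).le]
          congr 2
          rw [mul_left_comm, ← Real.exp_add]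
          ring_nf
        · rw [Set.indicator_of_notMem (by simpa using h), Set.indicator_of_notMem (by simpa using h),
            mul_zero]
    _ = ∫⁻ u, (Set.Ioi (0 : ℝ)).indicator (fun u => ENNReal.ofReal (Real.exp (-(r * t))) *
          (exponentialPDF r u * f u)) u :=
        lintegral_sub_right_eq_self _ t
    _ = ∫⁻ u, ENNReal.ofReal (Real.exp (-(r * t))) * (exponentialPDF r u * f u) := by
        refine lintegral_congr_ae ?_
        filter_upwards [compl_mem_ae_iff.2 (Real.volume_singleton (a := 0))] with u hu
        rcases lt_or_gt_of_ne (show u ≠ 0 from hu) with h | h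
        · rw [Set.indicator_of_notMem (by simpa using h.le), exponentialPDF_of_neg h]
          simp
        · rw [Set.indicator_of_mem (Set.mem_Ioi.2 h)]
    _ = _ := by
        rw [lintegral_const_mul _ hg, lintegral_expMeasure r hf]

/-- Exponential tilting of an exponential distribution. -/
lemma lintegral_exp_mul_expMeasure {r θ : ℝ} (hr : 0 < r) (hθ : 0 ≤ θ) {f : ℝ → ℝ≥0∞}
    (hf : Measurable f) :
    ∫⁻ a, ENNReal.ofReal (Real.exp (-(θ * a))) * f a ∂expMeasure r =
      ENNReal.ofReal (r / (r + θ)) * ∫⁻ a, f a ∂expMeasure (r + θ) := by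
  have hm : Measurable fun a : ℝ => ENNReal.ofReal (Real.exp (-(θ * a))) * f a := by fun_prop
  have hg : Measurable fun a => exponentialPDF (r + θ) a * f a :=
    (measurable_exponentialPDF _).mul hf
  rw [lintegral_expMeasure r hm, lintegral_expMeasure _ hf, ← lintegral_const_mul _ hg]
  refine lintegral_congr fun a => ?_
  rcases lt_or_ge a 0 with h | h
  · simp [exponentialPDF_of_neg h]
  · rw [exponentialPDF_of_nonneg h, exponentialPDF_of_nonneg h, ← mul_assoc, ← mul_assoc,
      ← ENNReal.ofReal_mul (by positivity), ← ENNReal.ofReal_mul (by positivity)]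
    congr 2
    have : r + θ ≠ 0 := by positivity
    rw [mul_assoc, ← Real.exp_add, ← mul_assoc, div_mul_cancel₀ _ this]
    ring_nf

/-- On the half-line, a times the exponential density is 1/r times the Gamma(2, r) density, which
has total mass one. -/
lemma lintegral_ofReal_expMeasure {r : ℝ} (hr : 0 < r) :
    ∫⁻ a, ENNReal.ofReal a ∂expMeasure r = ENNReal.ofReal (1 / r) := by
  rw [lintegral_expMeasure r ENNReal.measurable_ofReal]
  have : ∀ a, exponentialPDF r a * ENNReal.ofReal a = ENNReal.ofReal (1 / r) * gammaPDF 2 r a := by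
    intro a
    rcases lt_or_ge a 0 with h | h
    · simp [exponentialPDF_of_neg h, gammaPDF_of_neg h]
    · rw [exponentialPDF_of_nonneg h, gammaPDF_of_nonneg h, ← ENNReal.ofReal_mul (by positivity),
        ← ENNReal.ofReal_mul (by positivity)]
      congr 1
      rw [Real.Gamma_two]
      norm_num
      field_simp
  simp_rw [this]
  have hg : Measurable (gammaPDF 2 r) := (measurable_gammaPDFReal 2 r).ennreal_ofReal
  rw [lintegral_const_mul _ hg,
    lintegral_gammaPDF_eq_one two_pos hr, mul_one]

lemma integrable_id_expMeasure {r : ℝ} (hr : 0 < r) : Integrable (fun a : ℝ => a) (expMeasure r) := by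
  refine ⟨measurable_id.aestronglyMeasurable, ?_⟩
  rw [hasFiniteIntegral_iff_ofReal ((ae_pos_expMeasure r).mono fun a ha => ha.le),
    lintegral_ofReal_expMeasure hr]
  exact ENNReal.ofReal_lt_top

lemma integral_id_expMeasure {r : ℝ} (hr : 0 < r) : ∫ a, a ∂expMeasure r = 1 / r := by
  rw [integral_eq_lintegral_of_nonneg_ae ((ae_pos_expMeasure r).mono fun a ha => ha.le)
    measurable_id.aestronglyMeasurable, lintegral_ofReal_expMeasure hr,
    ENNReal.toReal_ofReal (by positivity)]

/-! ### The law of a marked Poisson stream and its invariance under time shifts. -/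

namespace PacketStream

/-- The law of a stream of independent packets with common law `ρ`. -/
def law (ρ : Measure (ℝ × ℝ)) : Measure PacketStream := Measure.infinitePi fun _ => ρ

instance (ρ : Measure (ℝ × ℝ)) [IsProbabilityMeasure ρ] : IsProbabilityMeasure (law ρ) := by
  unfold law
  infer_instance

lemma map_eval_law (ρ : Measure (ℝ × ℝ)) [IsProbabilityMeasure ρ] (i : ℕ) :
    (law ρ).map (fun w => w i) = ρ := Measure.infinitePi_map_eval _ i

/-- The first packet is independent of the rest of the stream, which has the law of the stream. -/
lemma map_cons_law (ρ : Measure (ℝ × ℝ)) [IsProbabilityMeasure ρ] :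
    (ρ.prod (law ρ)).map (fun p => cons p.1 p.2) = law ρ := by
  classical
  refine Measure.eq_infinitePi _ fun s t ht => ?_
  -- Padding with trivial sides turns the box into one over an initial segment, whose preimage under
  -- prepending is a side for the first packet times a box for the rest.
  obtain ⟨n, hn⟩ : ∃ n, s ⊆ Finset.range (n + 1) := by
    obtain ⟨n, hn⟩ := s.exists_nat_subset_range
    exact ⟨n, hn.trans (Finset.range_mono n.le_succ)⟩
  set t' : ℕ → Set (ℝ × ℝ) := fun i => if i ∈ s then t i else Set.univ with ht'
  have hm' : ∀ i, MeasurableSet (t' i) := fun i => by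
    simp only [ht']
    split_ifs
    exacts [ht i, MeasurableSet.univ]
  have hpi : Set.pi (s : Set ℕ) t = Set.pi (Finset.range (n + 1) : Set ℕ) t' := by
    ext w
    simp only [Set.mem_pi, Finset.mem_coe, ht']
    constructor
    · intro h i _
      split_ifs with hi
      exacts [h i hi, Set.mem_univ _]
    · intro h i hi
      have := h i (hn hi)
      rwa [if_pos hi] at this
  have hprod : ∏ i ∈ s, ρ (t i) = ∏ i ∈ Finset.range (n + 1), ρ (t' i) := by
    rw [← Finset.prod_subset hn (f := fun i => ρ (t' i))]
    · exact Finset.prod_congr rfl fun i hi => by simp [ht', hi]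
    · intro i _ hi
      simp [ht', hi]
  have hpre : (fun p : (ℝ × ℝ) × PacketStream => cons p.1 p.2) ⁻¹'
      (Set.pi (Finset.range (n + 1) : Set ℕ) t') =
      t' 0 ×ˢ Set.pi (Finset.range n : Set ℕ) fun i => t' (i + 1) := by
    ext ⟨z, w⟩
    simp only [Set.mem_preimage, Set.mem_pi, Finset.mem_coe, Finset.mem_range, Set.mem_prod]
    constructor
    · exact fun h => ⟨h 0 n.succ_pos, fun i hi => h (i + 1) (Nat.succ_lt_succ hi)⟩
    · rintro ⟨h0, h⟩ i hi
      cases i with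
      | zero => exact h0
      | succ i => exact h i (Nat.lt_of_succ_lt_succ hi)
  rw [hpi, Measure.map_apply measurable_cons
    (MeasurableSet.pi (Finset.countable_toSet _) fun i _ => hm' i), hpre, Measure.prod_prod, law,
    Measure.infinitePi_pi _ fun i _ => hm' _, hprod, Finset.prod_range_succ', mul_comm]

lemma law_apply_eq_lintegral_cons (ρ : Measure (ℝ × ℝ)) [IsProbabilityMeasure ρ]
    {B : Set PacketStream} (hB : MeasurableSet B) :
    law ρ B = ∫⁻ z, law ρ {w | cons z w ∈ B} ∂ρ := by
  conv_lhs => rw [← map_cons_law ρ, Measure.map_apply measurable_cons hB,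
    Measure.prod_apply (measurable_cons hB)]
  rfl

section

variable {r : ℝ} {G : Measure ℝ} [IsProbabilityMeasure G]

lemma ae_law_pos (hr : 0 < r) :
    ∀ᵐ w ∂law ((expMeasure r).prod G), ∀ i, 0 < (w i).1 := by
  have := isProbabilityMeasure_expMeasure hr
  rw [ae_all_iff]
  intro i
  have h : ∀ᵐ z ∂(expMeasure r).prod G, 0 < z.1 :=
    Measure.quasiMeasurePreserving_fst.ae (ae_pos_expMeasure r)
  rw [← map_eval_law ((expMeasure r).prod G) i] at h
  exact ae_of_ae_map (measurable_pi_apply i).aemeasurable h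

lemma ae_law_snd_nonneg (hr : 0 < r) (hG : ∀ᵐ s ∂G, 0 ≤ s) :
    ∀ᵐ w ∂law ((expMeasure r).prod G), ∀ i, 0 ≤ (w i).2 := by
  have := isProbabilityMeasure_expMeasure hr
  rw [ae_all_iff]
  intro i
  have h : ∀ᵐ z ∂(expMeasure r).prod G, 0 ≤ z.2 :=
    Measure.quasiMeasurePreserving_snd.ae hG
  rw [← map_eval_law ((expMeasure r).prod G) i] at h
  exact ae_of_ae_map (measurable_pi_apply i).aemeasurable h

/-- By the strong law the arrival times grow like i/r. -/
lemma ae_law_unbounded (hr : 0 < r) :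
    ∀ᵐ w ∂law ((expMeasure r).prod G), w.Unbounded := by
  have := isProbabilityMeasure_expMeasure hr
  set ρ := (expMeasure r).prod G with hρ
  have hmap : ∀ i, (law ρ).map (fun w => (w i).1) = expMeasure r := fun i => by
    have : (fun w : PacketStream => (w i).1) = Prod.fst ∘ fun w => w i := rfl
    rw [this, ← Measure.map_map measurable_fst (measurable_pi_apply i), map_eval_law, hρ,
      Measure.map_fst_prod, measure_univ, one_smul]
  have hm : ∀ i, Measurable fun w : PacketStream => (w i).1 := fun i => by fun_prop
  have hind : iIndepFun (fun (i : ℕ) (w : PacketStream) => (w i).1) (law ρ) :=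
    iIndepFun_infinitePi (P := fun _ => ρ) (X := fun _ (z : ℝ × ℝ) => z.1) fun _ => measurable_fst
  have hint : Integrable (fun w : PacketStream => (w 0).1) (law ρ) := by
    have := integrable_id_expMeasure hr
    rw [← hmap 0] at this
    exact this.comp_measurable (hm 0)
  have hmean : ∫ w, (w 0).1 ∂law ρ = 1 / r := by
    rw [← integral_id_expMeasure hr, ← hmap 0, integral_map (hm 0).aemeasurable
      measurable_id'.aestronglyMeasurable]
  have := strong_law_ae_real (fun (i : ℕ) (w : PacketStream) => (w i).1) hint
    (fun i j hij => hind.indepFun hij)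
    (fun i => ⟨(hm i).aemeasurable, (hm 0).aemeasurable, by rw [hmap, hmap]⟩)
  filter_upwards [this] with w hw
  rw [hmean] at hw
  have h1 : Tendsto (fun n : ℕ => ∑ i ∈ Finset.range n, (w i).1) atTop atTop := by
    have := hw.pos_mul_atTop (by positivity) tendsto_natCast_atTop_atTop
    refine this.congr' ?_
    filter_upwards [eventually_ne_atTop 0] with n hn
    exact div_mul_cancel₀ _ (by exact_mod_cast hn)
  intro u
  obtain ⟨i, hi⟩ := (((tendsto_add_atTop_iff_nat 1).2 h1).eventually_gt_atTop u).exists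
  exact ⟨i, hi⟩

/-- Condition on the first arrival time a. If a > s, memorylessness gives a contribution exp(-rs) ·
law(B). If a ≤ s, the later packets are watched from s - a, which again lies in [0, s₀], so the
induction hypothesis applies. The constant is the probability that one of n inter-arrival times
exceeds s₀. It tends to 1, and a lower bound is enough because the shifted law and the original one
are both probability measures. -/
lemma map_shift_law_ge (hr : 0 < r) {s₀ : ℝ} (hs₀ : 0 ≤ s₀) {B : Set PacketStream}
    (hB : MeasurableSet B) (n : ℕ) :
    ∀ s, 0 ≤ s → s ≤ s₀ → ENNReal.ofReal (1 - (1 - Real.exp (-(r * s₀))) ^ n) *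
      law ((expMeasure r).prod G) B ≤ law ((expMeasure r).prod G) (shift s ⁻¹' B) := by
  have := isProbabilityMeasure_expMeasure hr
  set ρ := (expMeasure r).prod G with hρ
  set q := 1 - Real.exp (-(r * s₀)) with hq
  have hq0 : 0 ≤ q := by
    have : Real.exp (-(r * s₀)) ≤ 1 := Real.exp_le_one_iff.2 (by nlinarith)
    linarith
  have hq1 : q ≤ 1 := by linarith [Real.exp_pos (-(r * s₀))]
  induction n with
  | zero => simp
  | succ n ih =>
    intro s hs hss
    set C := ENNReal.ofReal (1 - q ^ n) * law ρ B with hC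
    have hh : Measurable fun z => law ρ {w | cons z w ∈ B} :=
      measurable_measure_prodMk_left (measurable_cons hB)
    set H : ℝ → ℝ≥0∞ := fun a => ∫⁻ b, law ρ {w | cons (a, b) w ∈ B} ∂G with hH
    have hHm : Measurable H := hh.lintegral_prod_right'
    have hHint : ∫⁻ a, H a ∂expMeasure r = law ρ B := by
      rw [law_apply_eq_lintegral_cons ρ hB, hρ, lintegral_prod _ hh.aemeasurable]
    have hbig : ∫⁻ a, ((Set.Ioi s).indicator (fun a => H (a - s)) a +
        (Set.Iic s).indicator (fun _ => C) a) ∂expMeasure r ≤ law ρ (shift s ⁻¹' B) := by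
      have hm2 : Measurable fun z => law ρ {w | cons z w ∈ shift s ⁻¹' B} :=
        measurable_measure_prodMk_left (measurable_cons (measurable_shift_const s hB))
      rw [law_apply_eq_lintegral_cons ρ (measurable_shift_const s hB), hρ,
        lintegral_prod _ hm2.aemeasurable]
      refine lintegral_mono_ae ?_
      filter_upwards [ae_pos_expMeasure r] with a ha
      rcases lt_or_ge s a with h | h
      · rw [Set.indicator_of_mem (Set.mem_Ioi.2 h), Set.indicator_of_notMem (by simpa using h),
          add_zero]
        refine lintegral_mono fun b => ?_
        simp only [Set.mem_preimage, shift_cons_of_lt h]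
        exact le_rfl
      · rw [Set.indicator_of_notMem (by simpa using h), Set.indicator_of_mem (Set.mem_Iic.2 h),
          zero_add]
        calc C = ∫⁻ _ : ℝ, C ∂G := by simp
          _ ≤ _ := by
            refine lintegral_mono fun b => ?_
            have : law ρ {w | cons (a, b) w ∈ shift s ⁻¹' B} = law ρ (shift (s - a) ⁻¹' B) := by
              refine measure_congr ?_
              filter_upwards [ae_law_unbounded (G := G) hr] with w hw
              refine propext ?_
              change shift s (cons (a, b) w) ∈ B ↔ shift (s - a) w ∈ B
              rw [shift_cons_of_le h hw]
            simp only
            rw [this]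
            exact ih (s - a) (by linarith) (by linarith)
    refine le_trans ?_ hbig
    rw [lintegral_add_right _ (measurable_const.indicator measurableSet_Iic),
      lintegral_indicator measurableSet_Ioi, setLIntegral_Ioi_expMeasure r hs hHm, hHint,
      lintegral_indicator_const measurableSet_Iic, expMeasure_Iic hr hs, hC, mul_right_comm,
      ← add_mul]
    gcongr
    have he1 : Real.exp (-(r * s)) ≤ 1 := Real.exp_le_one_iff.2 (by nlinarith)
    have he2 : Real.exp (-(r * s₀)) ≤ Real.exp (-(r * s)) := Real.exp_le_exp.2 (by nlinarith)
    have hqn : q ^ n ≤ 1 := pow_le_one₀ hq0 hq1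
    have hqn0 : 0 ≤ q ^ n := pow_nonneg hq0 n
    rw [← ENNReal.ofReal_mul (by linarith), ← ENNReal.ofReal_add (Real.exp_pos _).le
      (mul_nonneg (by linarith) (by linarith))]
    refine ENNReal.ofReal_le_ofReal ?_
    -- With e = exp(-rs), the claim is e + (1 - e)(1 - q^n) ≥ 1 - q^(n+1), that is (1 - e) q^n ≤ q ·
    -- q^n, and 1 - e ≤ q because s ≤ s₀.
    rw [pow_succ]
    nlinarith

/-- A marked Poisson process watched from a fixed time on has the law of the original one. -/
lemma map_shift_law (hr : 0 < r) {s : ℝ} (hs : 0 ≤ s) :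
    (law ((expMeasure r).prod G)).map (shift s) = law ((expMeasure r).prod G) := by
  have := isProbabilityMeasure_expMeasure hr
  have : IsProbabilityMeasure ((law ((expMeasure r).prod G)).map (shift s)) :=
    Measure.isProbabilityMeasure_map (measurable_shift_const s).aemeasurable
  symm
  refine Measure.eq_of_le_of_isProbabilityMeasure (Measure.le_iff.2 fun B hB => ?_)
  rw [Measure.map_apply (measurable_shift_const s) hB]
  have hlim : Tendsto (fun n : ℕ => ENNReal.ofReal (1 - (1 - Real.exp (-(r * s))) ^ n) *
      law ((expMeasure r).prod G) B) atTop (𝓝 (ENNReal.ofReal (1 - 0) *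
      law ((expMeasure r).prod G) B)) := by
    refine ENNReal.Tendsto.mul_const (ENNReal.tendsto_ofReal ?_) (Or.inr (measure_ne_top _ _))
    refine tendsto_const_nhds.sub (tendsto_pow_atTop_nhds_zero_of_lt_one ?_ ?_)
    · have : Real.exp (-(r * s)) ≤ 1 := Real.exp_le_one_iff.2 (by nlinarith)
      linarith
    · linarith [Real.exp_pos (-(r * s))]
  rw [sub_zero, ENNReal.ofReal_one, one_mul] at hlim
  exact le_of_tendsto' hlim fun n => map_shift_law_ge hr hs hB n s hs le_rfl

/-- The law of the stream watched from time `t + s` on, on the event that the first packet arrives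
after time `t`. -/
lemma law_lt_and_shift_mem (hr : 0 < r) {t s : ℝ} (ht : 0 ≤ t) (hs : 0 ≤ s) {B : Set PacketStream}
    (hB : MeasurableSet B) :
    law ((expMeasure r).prod G) {w | t < (w 0).1 ∧ shift (t + s) w ∈ B} =
      ENNReal.ofReal (Real.exp (-(r * t))) * law ((expMeasure r).prod G) B := by
  have := isProbabilityMeasure_expMeasure hr
  set ρ := (expMeasure r).prod G with hρ
  have hmeas : MeasurableSet {w : PacketStream | t < (w 0).1 ∧ shift (t + s) w ∈ B} :=
    (measurableSet_lt (g := fun w : PacketStream => (w 0).1) measurable_const (by fun_prop)).inter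
      (measurable_shift_const (t + s) hB)
  have hh : Measurable fun z => law ρ {w | cons z w ∈ shift s ⁻¹' B} :=
    measurable_measure_prodMk_left (measurable_cons (measurable_shift_const s hB))
  have hm2 : Measurable fun z => law ρ {w | cons z w ∈
      {w : PacketStream | t < (w 0).1 ∧ shift (t + s) w ∈ B}} :=
    measurable_measure_prodMk_left (measurable_cons hmeas)
  -- Stationarity inserts the shift by `s` on the right-hand side. What remains is to remove `t`,
  -- which is memorylessness of the first inter-arrival time alone.
  have hB' : law ρ B = law ρ (shift s ⁻¹' B) := by
    rw [← Measure.map_apply (measurable_shift_const s) hB, map_shift_law hr hs]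
  rw [hB', law_apply_eq_lintegral_cons ρ (measurable_shift_const s hB),
    law_apply_eq_lintegral_cons ρ hmeas, hρ, lintegral_prod _ hh.aemeasurable,
    lintegral_prod _ hm2.aemeasurable,
    ← setLIntegral_Ioi_expMeasure r ht hh.lintegral_prod_right',
    ← lintegral_indicator measurableSet_Ioi]
  refine lintegral_congr fun a => ?_
  by_cases h : t < a
  · rw [Set.indicator_of_mem (Set.mem_Ioi.2 h)]
    simp [h, shift_add_cons]
  · rw [Set.indicator_of_notMem (by simpa using h)]
    simp [h]

end

end PacketStream

/-! ### The joint input, its first packet, and the input after that packet's departure. -/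

open PacketStream

lemma PacketStream.lintegral_law_eq_lintegral_cons (ρ : Measure (ℝ × ℝ)) [IsProbabilityMeasure ρ]
    {f : PacketStream → ℝ≥0∞} (hf : Measurable f) :
    ∫⁻ w, f w ∂law ρ = ∫⁻ z, ∫⁻ w, f (cons z w) ∂law ρ ∂ρ := by
  conv_lhs => rw [← map_cons_law ρ, lintegral_map hf measurable_cons]
  exact lintegral_prod _ (hf.comp measurable_cons).aemeasurable

/-- The joint law of the input streams of all classes. -/
def systemLaw {N : ℕ} (lam : Fin N → ℝ) (G : Fin N → Measure ℝ) :
    Measure (Fin N → PacketStream) :=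
  Measure.pi fun n => law ((expMeasure (lam n)).prod (G n))

/-- The first packet of class `n` arrives before all packets of other classes. -/
def IsFirst {N : ℕ} (n : Fin N) (W : Fin N → PacketStream) : Prop :=
  ∀ k, k ≠ n → (W n 0).1 < (W k 0).1

lemma IsFirst.unique {N : ℕ} {W : Fin N → PacketStream} {n m : Fin N} (hn : IsFirst n W)
    (hm : IsFirst m W) : n = m := by
  by_contra h
  exact lt_asymm (hn m (Ne.symm h)) (hm n h)

lemma measurableSet_isFirst {N : ℕ} (n : Fin N) :
    MeasurableSet {W : Fin N → PacketStream | IsFirst n W} := by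
  have : {W : Fin N → PacketStream | IsFirst n W} =
      ⋂ k, ⋂ _ : k ≠ n, {W | (W n 0).1 < (W k 0).1} := by
    ext W
    simp [IsFirst]
  rw [this]
  exact MeasurableSet.iInter fun k => MeasurableSet.iInter fun _ =>
    measurableSet_lt (by fun_prop) (by fun_prop)

open Classical in
/-- The class of the first arriving packet. -/
def firstClass {N : ℕ} (W : Fin (N + 1) → PacketStream) : Fin (N + 1) :=
  -- The value 0 is arbitrary: almost surely some class is first.
  if h : ∃ n, IsFirst n W then h.choose else 0

lemma IsFirst.firstClass_eq {N : ℕ} {W : Fin (N + 1) → PacketStream} {n : Fin (N + 1)}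
    (hn : IsFirst n W) : firstClass W = n := by
  have h : ∃ n, IsFirst n W := ⟨n, hn⟩
  rw [firstClass, dif_pos h]
  exact h.choose_spec.unique hn

lemma measurable_firstClass {N : ℕ} :
    Measurable (firstClass : (Fin (N + 1) → PacketStream) → Fin (N + 1)) := by
  refine measurable_to_countable' fun n => ?_
  have hne : MeasurableSet {W : Fin (N + 1) → PacketStream | ∃ n, IsFirst n W} := by
    rw [Set.ofPred_exists]
    exact MeasurableSet.iUnion measurableSet_isFirst
  have : firstClass ⁻¹' {n} = {W : Fin (N + 1) → PacketStream | IsFirst n W} ∪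
      ({W | ∃ n, IsFirst n W}ᶜ ∩ {_W | n = 0}) := by
    ext W
    by_cases h : ∃ m, IsFirst m W
    · obtain ⟨m, hm⟩ := h
      simp only [Set.mem_preimage, hm.firstClass_eq, Set.mem_singleton_iff, Set.mem_union,
        Set.mem_ofPred_eq, Set.mem_inter_iff, Set.mem_compl_iff]
      constructor
      · rintro rfl
        exact Or.inl hm
      · rintro (h | h)
        · exact hm.unique h
        · exact absurd ⟨m, hm⟩ h.1
    · have h0 : firstClass W = 0 := dif_neg h
      have hn : ¬ IsFirst n W := fun hn => h ⟨n, hn⟩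
      simp only [Set.mem_preimage, h0, Set.mem_singleton_iff, Set.mem_union, Set.mem_ofPred_eq, hn,
        Set.mem_inter_iff, Set.mem_compl_iff, h, not_false_eq_true, true_and, false_or]
      exact eq_comm
  rw [this]
  exact (measurableSet_isFirst n).union (hne.compl.inter (MeasurableSet.const _))

/-- The class, the arrival time and the service time of the first arriving packet. -/
def firstPacket {N : ℕ} (W : Fin (N + 1) → PacketStream) : Fin (N + 1) × (ℝ × ℝ) :=
  (firstClass W, W (firstClass W) 0)

/-- The time at which the first arriving packet leaves the server. -/
def firstDeparture {N : ℕ} (W : Fin (N + 1) → PacketStream) : ℝ :=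
  (firstPacket W).2.1 + (firstPacket W).2.2

/-- The input streams seen from the departure of the first arriving packet on. -/
def nextInput {N : ℕ} (W : Fin (N + 1) → PacketStream) : Fin (N + 1) → PacketStream :=
  fun k => shift (firstDeparture W) (W k)

lemma measurable_firstPacket {N : ℕ} : Measurable (firstPacket (N := N)) := by
  have : Measurable fun q : (Fin (N + 1) → PacketStream) × Fin (N + 1) => q.1 q.2 0 :=
    measurable_from_prod_countable_left fun i => by fun_prop
  exact measurable_firstClass.prodMk (this.comp (measurable_id.prodMk measurable_firstClass))

lemma measurable_firstDeparture {N : ℕ} : Measurable (firstDeparture (N := N)) :=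
  measurable_firstPacket.snd.fst.add measurable_firstPacket.snd.snd

lemma measurable_nextInput {N : ℕ} : Measurable (nextInput (N := N)) :=
  measurable_pi_lambda _ fun k =>
    Measurable.packetStream_shift measurable_firstDeparture (measurable_pi_apply k)

lemma sum_lam_pos {N : ℕ} {lam : Fin (N + 1) → ℝ} (hlam : ∀ n, 0 < lam n) : 0 < ∑ k, lam k :=
  Finset.sum_pos (fun k _ => hlam k) Finset.univ_nonempty

/-! ### Regeneration: the first packet is independent of the subsequent input. -/

section

variable {N : ℕ} {lam : Fin (N + 1) → ℝ} {G : Fin (N + 1) → Measure ℝ}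

/-- The law of the class, the arrival time and the service time of the first packet. -/
def packetLaw (lam : Fin (N + 1) → ℝ) (G : Fin (N + 1) → Measure ℝ) :
    Measure (Fin (N + 1) × (ℝ × ℝ)) :=
  ∑ n, ENNReal.ofReal (lam n / ∑ k, lam k) •
    ((expMeasure (∑ k, lam k)).prod (G n)).map (Prod.mk n)

lemma sum_ofReal_lam_div (hlam : ∀ n, 0 < lam n) :
    ∑ n, ENNReal.ofReal (lam n / ∑ k, lam k) = 1 := by
  have hs := sum_lam_pos hlam
  rw [← ENNReal.ofReal_sum_of_nonneg fun n _ => div_nonneg (hlam n).le hs.le, ← Finset.sum_div,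
    div_self hs.ne', ENNReal.ofReal_one]

lemma packetLaw_apply {A : Set (Fin (N + 1) × (ℝ × ℝ))} (hA : MeasurableSet A) :
    packetLaw lam G A = ∑ n, ENNReal.ofReal (lam n / ∑ k, lam k) *
      (expMeasure (∑ k, lam k)).prod (G n) (Prod.mk n ⁻¹' A) := by
  simp only [packetLaw, Measure.coe_finsetSum, Finset.sum_apply, Measure.smul_apply, smul_eq_mul]
  exact Finset.sum_congr rfl fun n _ => by rw [Measure.map_apply measurable_prodMk_left hA]

lemma integrable_packetLaw {f : Fin (N + 1) × (ℝ × ℝ) → ℝ} (hf : Measurable f)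
    (hint : ∀ n, Integrable (fun z => f (n, z)) ((expMeasure (∑ k, lam k)).prod (G n))) :
    Integrable f (packetLaw lam G) := by
  rw [packetLaw, integrable_finsetSum_measure]
  intro n _
  refine Integrable.smul_measure ?_ ENNReal.ofReal_ne_top
  rw [integrable_map_measure hf.aestronglyMeasurable measurable_prodMk_left.aemeasurable]
  exact hint n

lemma integral_packetLaw (hlam : ∀ n, 0 < lam n) {f : Fin (N + 1) × (ℝ × ℝ) → ℝ}
    (hf : Measurable f)
    (hint : ∀ n, Integrable (fun z => f (n, z)) ((expMeasure (∑ k, lam k)).prod (G n))) :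
    ∫ z, f z ∂packetLaw lam G =
      ∑ n, lam n / (∑ k, lam k) * ∫ z, f (n, z) ∂(expMeasure (∑ k, lam k)).prod (G n) := by
  have hs := sum_lam_pos hlam
  rw [packetLaw, integral_finsetSum_measure]
  · refine Finset.sum_congr rfl fun n _ => ?_
    rw [integral_smul_measure, ENNReal.toReal_ofReal (div_nonneg (hlam n).le hs.le), smul_eq_mul,
      integral_map measurable_prodMk_left.aemeasurable hf.aestronglyMeasurable]
  · intro n _
    refine Integrable.smul_measure ?_ ENNReal.ofReal_ne_top
    rw [integrable_map_measure hf.aestronglyMeasurable measurable_prodMk_left.aemeasurable]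
    exact hint n

variable [∀ n, IsProbabilityMeasure (G n)]

lemma isProbabilityMeasure_systemLaw (hlam : ∀ n, 0 < lam n) :
    IsProbabilityMeasure (systemLaw lam G) := by
  have := fun n => isProbabilityMeasure_expMeasure (hlam n)
  unfold systemLaw
  infer_instance

/-- The joint law of the first packet, of class `n`, and of the input after its departure. -/
lemma systemLaw_isFirst_inter (hlam : ∀ n, 0 < lam n) (hG : ∀ n, ∀ᵐ s ∂G n, 0 ≤ s)
    (n : Fin (N + 1)) {A : Set (ℝ × ℝ)} (hA : MeasurableSet A)
    {B : Fin (N + 1) → Set PacketStream} (hB : ∀ k, MeasurableSet (B k)) :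
    systemLaw lam G {W | IsFirst n W ∧ W n 0 ∈ A ∧
      ∀ k, shift ((W n 0).1 + (W n 0).2) (W k) ∈ B k} =
    ENNReal.ofReal (lam n / ∑ k, lam k) * (expMeasure (∑ k, lam k)).prod (G n) A *
      ∏ k, law ((expMeasure (lam k)).prod (G k)) (B k) := by
  have := fun n => isProbabilityMeasure_expMeasure (hlam n)
  have := isProbabilityMeasure_expMeasure (sum_lam_pos hlam)
  set P : Fin (N + 1) → Measure PacketStream :=
    fun k => law ((expMeasure (lam k)).prod (G k)) with hP
  set θ : ℝ := ∑ j, lam (n.succAbove j) with hθ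
  have hsum : ∑ k, lam k = lam n + θ := Fin.sum_univ_succAbove lam n
  have hθ0 : 0 ≤ θ := Finset.sum_nonneg fun j _ => (hlam _).le
  -- The event is rewritten with the stream of class `n` separated from the others, so that one can
  -- integrate over the latter with the former fixed.
  set E : Set (PacketStream × (Fin N → PacketStream)) :=
    {p | (∀ j, (p.1 0).1 < (p.2 j 0).1) ∧ p.1 0 ∈ A ∧
      shift ((p.1 0).1 + (p.1 0).2) p.1 ∈ B n ∧
      ∀ j, shift ((p.1 0).1 + (p.1 0).2) (p.2 j) ∈ B (n.succAbove j)} with hE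
  have hEm : MeasurableSet E := by
    have h0 : Measurable fun p : PacketStream × (Fin N → PacketStream) => p.1 0 := by fun_prop
    have h1 : ∀ j, MeasurableSet
        {p : PacketStream × (Fin N → PacketStream) | (p.1 0).1 < (p.2 j 0).1} := fun j =>
      measurableSet_lt (by fun_prop) (by fun_prop)
    have h2 : Measurable fun p : PacketStream × (Fin N → PacketStream) =>
        shift ((p.1 0).1 + (p.1 0).2) p.1 :=
      (h0.fst.add h0.snd).packetStream_shift measurable_fst
    have h3 : ∀ j, Measurable fun p : PacketStream × (Fin N → PacketStream) =>
        shift ((p.1 0).1 + (p.1 0).2) (p.2 j) := fun j =>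
      (h0.fst.add h0.snd).packetStream_shift (by fun_prop)
    have : E = (⋂ j, {p | (p.1 0).1 < (p.2 j 0).1}) ∩ ((fun p => p.1 0) ⁻¹' A ∩
        ((fun p => shift ((p.1 0).1 + (p.1 0).2) p.1) ⁻¹' (B n) ∩
        ⋂ j, (fun p => shift ((p.1 0).1 + (p.1 0).2) (p.2 j)) ⁻¹' (B (n.succAbove j)))) := by
      ext p
      simp [hE]
    rw [this]
    exact (MeasurableSet.iInter h1).inter ((h0 hA).inter ((h2 (hB n)).inter
      (MeasurableSet.iInter fun j => h3 j (hB _))))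
  have hpre : {W : Fin (N + 1) → PacketStream | IsFirst n W ∧ W n 0 ∈ A ∧
      ∀ k, shift ((W n 0).1 + (W n 0).2) (W k) ∈ B k} =
      MeasurableEquiv.piFinSuccAbove (fun _ => PacketStream) n ⁻¹' E := by
    ext W
    simp only [hE, Set.mem_ofPred_eq, Set.mem_preimage, MeasurableEquiv.piFinSuccAbove_apply,
      Fin.insertNthEquiv_symm_apply, Fin.removeNth]
    refine and_congr ⟨fun h j => h _ (Fin.succAbove_ne n j), fun h k hk => ?_⟩
      (and_congr Iff.rfl (Fin.forall_iff_succAbove n))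
    obtain ⟨j, rfl⟩ := Fin.exists_succAbove_eq hk
    exact h j
  have hmp := measurePreserving_piFinSuccAbove P n
  have hdens : Measurable fun z : ℝ × ℝ => A.indicator
      (fun z => ENNReal.ofReal (Real.exp (-(θ * z.1)))) z :=
    Measurable.indicator (by fun_prop) hA
  have hcond : Measurable fun w : PacketStream => shift ((w 0).1 + (w 0).2) w :=
    Measurable.packetStream_shift (by fun_prop) measurable_id
  rw [hpre, systemLaw, hmp.measure_preimage_equiv, Measure.prod_apply hEm]
  calc ∫⁻ w, Measure.pi (fun j => P (n.succAbove j)) (Prod.mk w ⁻¹' E) ∂P n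
      = ∫⁻ w, (A.indicator (fun z => ENNReal.ofReal (Real.exp (-(θ * z.1)))) (w 0) *
          ∏ j, P (n.succAbove j) (B (n.succAbove j))) *
          (B n).indicator 1 (shift ((w 0).1 + (w 0).2) w) ∂P n := by
        refine lintegral_congr_ae ?_
        filter_upwards [ae_law_pos (G := G n) (hlam n), ae_law_snd_nonneg (hlam n) (hG n)]
          with w hw1 hw2
        by_cases hwA : w 0 ∈ A ∧ shift ((w 0).1 + (w 0).2) w ∈ B n
        -- Once the stream of class `n` is fixed, the conditions on the other classes decouple. Each
        -- contributes exp(-λ_k a) times the law of its target set, where a is the first class-n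
        -- arrival time, and the exponentials multiply to exp(-θ a).
        · have : Prod.mk w ⁻¹' E = Set.univ.pi fun j =>
              {v : PacketStream | (w 0).1 < (v 0).1 ∧
                shift ((w 0).1 + (w 0).2) v ∈ B (n.succAbove j)} := by
            ext V
            simp only [hE, Set.mem_preimage, Set.mem_ofPred_eq, hwA.1, hwA.2, true_and,
              Set.mem_univ_pi, forall_and]
          rw [this, Measure.pi_pi, Set.indicator_of_mem hwA.1, Set.indicator_of_mem hwA.2]
          simp only [hP]
          simp_rw [law_lt_and_shift_mem (hlam _) (hw1 0).le (hw2 0) (hB _)]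
          rw [Finset.prod_mul_distrib, ← ENNReal.ofReal_prod_of_nonneg
            fun j _ => (Real.exp_pos _).le, ← Real.exp_sum, Finset.sum_neg_distrib,
            ← Finset.sum_mul, ← hθ]
          simp
        · have : Prod.mk w ⁻¹' E = ∅ := by
            ext V
            simp only [hE, Set.mem_preimage, Set.mem_ofPred_eq, Set.mem_empty_iff_false, iff_false]
            exact fun h => hwA ⟨h.2.1, h.2.2.1⟩
          rw [this, measure_empty]
          rcases not_and_or.1 hwA with h | h <;> simp [h]
    _ = ∫⁻ z, A.indicator (fun z => ENNReal.ofReal (Real.exp (-(θ * z.1)))) z *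
          ((∏ j, P (n.succAbove j) (B (n.succAbove j))) * P n (B n))
          ∂(expMeasure (lam n)).prod (G n) := by
        simp only [hP]
        rw [lintegral_law_eq_lintegral_cons]
        · refine lintegral_congr_ae ?_
          filter_upwards [Measure.quasiMeasurePreserving_snd.ae (hG n)] with z hz
          simp only [cons_zero]
          rw [lintegral_const_mul, mul_assoc]
          · congr 2
            -- Class `n` itself loses its first packet, so its remaining stream is watched from the
            -- end of the service time `z.2` on.
            have hz' : ∀ᵐ w ∂law ((expMeasure (lam n)).prod (G n)),
                (B n).indicator (1 : PacketStream → ℝ≥0∞) (shift (z.1 + z.2) (cons z w)) =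
                (shift z.2 ⁻¹' B n).indicator 1 w := by
              filter_upwards [ae_law_unbounded (G := G n) (hlam n)] with w hw
              rw [shift_cons_of_le (a := z.1) (b := z.2) (by linarith) hw, add_sub_cancel_left]
              rfl
            rw [lintegral_congr_ae hz', lintegral_indicator_one (measurable_shift_const _ (hB n)),
              ← Measure.map_apply (measurable_shift_const _) (hB n), map_shift_law (hlam n) hz]
          · exact (measurable_one.indicator (hB n)).comp ((measurable_shift_const _).comp
              (measurable_cons.comp (measurable_const.prodMk measurable_id)))
        · exact ((hdens.comp (measurable_pi_apply 0)).mul_const _).mul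
            ((measurable_one.indicator (hB n)).comp hcond)
    _ = ENNReal.ofReal (lam n / ∑ k, lam k) * (expMeasure (∑ k, lam k)).prod (G n) A *
          ((∏ j, P (n.succAbove j) (B (n.succAbove j))) * P n (B n)) := by
        rw [lintegral_mul_const _ hdens]
        congr 1
        -- Tilting by exp(-θ a) turns rate λ_n into λ_n + θ = Λ and leaves the factor λ_n/Λ. This is
        -- why the arrival time of the first packet does not depend on its class.
        rw [lintegral_prod _ hdens.aemeasurable, Measure.prod_apply hA, hsum,
          ← lintegral_exp_mul_expMeasure (hlam n) hθ0 (measurable_measure_prodMk_left hA)]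
        refine lintegral_congr fun a => ?_
        rw [← lintegral_indicator_one (measurable_prodMk_left hA),
          ← lintegral_const_mul _ (measurable_one.indicator (measurable_prodMk_left hA))]
        refine lintegral_congr fun b => ?_
        by_cases h : (a, b) ∈ A <;> simp [Set.indicator, h]
    _ = _ := by
        rw [Fin.prod_univ_succAbove (fun k => P k (B k)) n, mul_comm (P n (B n))]

lemma systemLaw_isFirst (hlam : ∀ n, 0 < lam n) (hG : ∀ n, ∀ᵐ s ∂G n, 0 ≤ s) (n : Fin (N + 1)) :
    systemLaw lam G {W | IsFirst n W} = ENNReal.ofReal (lam n / ∑ k, lam k) := by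
  have := fun n => isProbabilityMeasure_expMeasure (hlam n)
  have := isProbabilityMeasure_expMeasure (sum_lam_pos hlam)
  have h := systemLaw_isFirst_inter hlam hG n MeasurableSet.univ
    (B := fun _ => Set.univ) fun _ => MeasurableSet.univ
  simpa using h

lemma disjoint_isFirst : Pairwise (Function.onFun Disjoint
    fun n : Fin (N + 1) => {W : Fin (N + 1) → PacketStream | IsFirst n W}) := fun _ _ hnm =>
  Set.disjoint_left.2 fun _ hn hm => hnm (hn.unique hm)

/-- The disjoint events have probabilities λ_n/Λ, which already add up to one, so no separate
argument about ties is needed. -/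
lemma ae_exists_isFirst (hlam : ∀ n, 0 < lam n) (hG : ∀ n, ∀ᵐ s ∂G n, 0 ≤ s) :
    ∀ᵐ W ∂systemLaw lam G, ∃ n, IsFirst n W := by
  have := isProbabilityMeasure_systemLaw (G := G) hlam
  have h1 : systemLaw lam G (⋃ n, {W | IsFirst n W}) = 1 := by
    rw [measure_iUnion disjoint_isFirst measurableSet_isFirst, tsum_fintype]
    simp_rw [systemLaw_isFirst hlam hG]
    exact sum_ofReal_lam_div hlam
  have h2 := (prob_compl_eq_zero_iff (MeasurableSet.iUnion measurableSet_isFirst)).2 h1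
  rw [← Set.ofPred_exists] at h2
  exact h2

/-- The first packet is independent of the input after its departure, which has the law of the
original input. -/
lemma systemLaw_firstPacket_inter_nextInput (hlam : ∀ n, 0 < lam n)
    (hG : ∀ n, ∀ᵐ s ∂G n, 0 ≤ s) {A : Set (Fin (N + 1) × (ℝ × ℝ))} (hA : MeasurableSet A)
    {B : Set (Fin (N + 1) → PacketStream)} (hB : MeasurableSet B) :
    systemLaw lam G (firstPacket ⁻¹' A ∩ nextInput ⁻¹' B) =
      packetLaw lam G A * systemLaw lam G B := by
  have := fun n => isProbabilityMeasure_expMeasure (hlam n)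
  have := isProbabilityMeasure_systemLaw (G := G) hlam
  have := isProbabilityMeasure_expMeasure (sum_lam_pos hlam)
  have hpi : ∀ B : Fin (N + 1) → Set PacketStream, (∀ k, MeasurableSet (B k)) →
      systemLaw lam G (firstPacket ⁻¹' A ∩ nextInput ⁻¹' (Set.univ.pi B)) =
        packetLaw lam G A * systemLaw lam G (Set.univ.pi B) := by
    intro B hB
    have hset : MeasurableSet (firstPacket ⁻¹' A ∩ nextInput ⁻¹' (Set.univ.pi B)) :=
      (measurable_firstPacket hA).inter (measurable_nextInput (MeasurableSet.univ_pi hB))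
    have hae : systemLaw lam G (firstPacket ⁻¹' A ∩ nextInput ⁻¹' (Set.univ.pi B)) =
        systemLaw lam G (⋃ n, ({W | IsFirst n W} ∩
          (firstPacket ⁻¹' A ∩ nextInput ⁻¹' (Set.univ.pi B)))) := by
      refine measure_congr ?_
      filter_upwards [ae_exists_isFirst hlam hG] with W hW
      refine propext ?_
      rw [← Set.iUnion_inter]
      exact ⟨fun h => ⟨Set.mem_iUnion.2 hW, h⟩, fun h => h.2⟩
    rw [hae, measure_iUnion (fun n m hnm => (disjoint_isFirst hnm).mono Set.inter_subset_left
      Set.inter_subset_left) (fun n => (measurableSet_isFirst n).inter hset), tsum_fintype,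
      packetLaw_apply hA, Finset.sum_mul]
    refine Finset.sum_congr rfl fun n _ => ?_
    have hn : {W | IsFirst n W} ∩ (firstPacket ⁻¹' A ∩ nextInput ⁻¹' (Set.univ.pi B)) =
        {W | IsFirst n W ∧ W n 0 ∈ Prod.mk n ⁻¹' A ∧
          ∀ k, shift ((W n 0).1 + (W n 0).2) (W k) ∈ B k} := by
      ext W
      simp only [Set.mem_inter_iff, Set.mem_ofPred_eq, Set.mem_preimage, Set.mem_univ_pi]
      refine and_congr_right fun h => ?_
      simp only [firstPacket, nextInput, firstDeparture, h.firstClass_eq]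
    rw [hn, systemLaw_isFirst_inter hlam hG n (measurable_prodMk_left hA) hB]
    congr 1
    rw [systemLaw, Measure.pi_pi]
  have huniv := hpi (fun _ => Set.univ) fun _ => MeasurableSet.univ
  simp only [Set.pi_univ, Set.preimage_univ, Set.inter_univ, measure_univ, mul_one] at huniv
  -- For fixed `A` both sides are finite measures that agree on boxes, hence on all measurable sets.
  have heq : ((systemLaw lam G).restrict (firstPacket ⁻¹' A)).map nextInput =
      packetLaw lam G A • systemLaw lam G := by
    refine ext_of_generate_finite _ generateFrom_pi.symm isPiSystem_pi ?_ ?_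
    · rintro _ ⟨B, hB, rfl⟩
      have hB' : ∀ k, MeasurableSet (B k) := fun k => hB k (Set.mem_univ k)
      rw [Measure.map_apply measurable_nextInput (MeasurableSet.univ_pi hB'),
        Measure.restrict_apply (measurable_nextInput (MeasurableSet.univ_pi hB')), Set.inter_comm,
        hpi B hB']
      rfl
    · rw [Measure.map_apply measurable_nextInput MeasurableSet.univ, Set.preimage_univ,
        Measure.restrict_apply_univ, huniv]
      simp
  have := congrArg (fun ν => ν B) heq
  simp only [Measure.map_apply measurable_nextInput hB,
    Measure.restrict_apply (measurable_nextInput hB), Measure.smul_apply, smul_eq_mul] at this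
  rw [Set.inter_comm, this]

lemma map_firstPacket_systemLaw (hlam : ∀ n, 0 < lam n) (hG : ∀ n, ∀ᵐ s ∂G n, 0 ≤ s) :
    (systemLaw lam G).map firstPacket = packetLaw lam G := by
  have := isProbabilityMeasure_systemLaw (G := G) hlam
  ext A hA
  rw [Measure.map_apply measurable_firstPacket hA]
  simpa using systemLaw_firstPacket_inter_nextInput hlam hG hA MeasurableSet.univ

lemma measurePreserving_nextInput (hlam : ∀ n, 0 < lam n) (hG : ∀ n, ∀ᵐ s ∂G n, 0 ≤ s) :
    MeasurePreserving nextInput (systemLaw lam G) (systemLaw lam G) := by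
  have := isProbabilityMeasure_systemLaw (G := G) hlam
  refine ⟨measurable_nextInput, ?_⟩
  ext B hB
  rw [Measure.map_apply measurable_nextInput hB]
  have h := systemLaw_firstPacket_inter_nextInput hlam hG MeasurableSet.univ hB
  rw [← map_firstPacket_systemLaw hlam hG,
    Measure.map_apply measurable_firstPacket MeasurableSet.univ] at h
  simpa using h

lemma indepFun_firstPacket_nextInput (hlam : ∀ n, 0 < lam n) (hG : ∀ n, ∀ᵐ s ∂G n, 0 ≤ s) :
    IndepFun firstPacket nextInput (systemLaw lam G) := by
  rw [indepFun_iff_measure_inter_preimage_eq_mul]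
  intro A B hA hB
  rw [systemLaw_firstPacket_inter_nextInput hlam hG hA hB, ← map_firstPacket_systemLaw hlam hG,
    Measure.map_apply measurable_firstPacket hA,
    (measurePreserving_nextInput hlam hG).measure_preimage hB.nullMeasurableSet]

/-- The strong law of large numbers for the successive admitted packets. -/
lemma tendsto_average_firstPacket (hlam : ∀ n, 0 < lam n) (hG : ∀ n, ∀ᵐ s ∂G n, 0 ≤ s)
    {f : Fin (N + 1) × (ℝ × ℝ) → ℝ} (hf : Measurable f) (hint : Integrable f (packetLaw lam G)) :
    ∀ᵐ W ∂systemLaw lam G, Tendsto (fun m : ℕ =>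
      (∑ i ∈ Finset.range m, f (firstPacket (nextInput^[i] W))) / m) atTop
      (𝓝 (∫ z, f z ∂packetLaw lam G)) := by
  have hmp := measurePreserving_nextInput hlam hG
  have hmeas : Measurable (f ∘ firstPacket) := hf.comp measurable_firstPacket
  rw [← map_firstPacket_systemLaw hlam hG] at hint ⊢
  rw [integral_map measurable_firstPacket.aemeasurable hf.aestronglyMeasurable]
  -- Pairwise independence suffices for this strong law. The `j`-th packet is a function of the
  -- input after the `i`-th departure, so the independence at stage 0 transfers through the
  -- measure-preserving `i`-th iterate.
  have hlt : ∀ i j, i < j → IndepFun (fun W => f (firstPacket (nextInput^[i] W)))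
      (fun W => f (firstPacket (nextInput^[j] W))) (systemLaw lam G) := by
    intro i j hij
    have h1 : IndepFun (f ∘ firstPacket) ((f ∘ firstPacket ∘ nextInput^[j - i - 1]) ∘ nextInput)
        (systemLaw lam G) :=
      (indepFun_firstPacket_nextInput hlam hG).comp hf
        (hmeas.comp (measurable_nextInput.iterate _))
    have hj : (fun W => f (firstPacket (nextInput^[j] W))) =
        ((f ∘ firstPacket ∘ nextInput^[j - i - 1]) ∘ nextInput) ∘ nextInput^[i] := by
      funext W
      simp only [Function.comp_apply]
      rw [← Function.iterate_succ_apply, ← Function.iterate_add_apply]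
      congr 3
      omega
    have hmj : Measurable ((f ∘ firstPacket ∘ nextInput^[j - i - 1]) ∘ nextInput) :=
      (hmeas.comp (measurable_nextInput.iterate _)).comp measurable_nextInput
    rw [hj, indepFun_iff_measure_inter_preimage_eq_mul]
    rw [indepFun_iff_measure_inter_preimage_eq_mul] at h1
    intro s t hs ht
    have h2 := h1 s t hs ht
    rw [← (hmp.iterate i).measure_preimage ((hmeas hs).inter (hmj ht)).nullMeasurableSet,
      ← (hmp.iterate i).measure_preimage (hmeas hs).nullMeasurableSet,
      ← (hmp.iterate i).measure_preimage (hmj ht).nullMeasurableSet] at h2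
    exact h2
  have := strong_law_ae_real (μ := systemLaw lam G)
    (fun (i : ℕ) W => f (firstPacket (nextInput^[i] W)))
    (hint.comp_measurable measurable_firstPacket) ?_ ?_
  · exact this
  · intro i j hij
    rcases lt_or_gt_of_ne hij with h | h
    · exact hlt i j h
    · exact (hlt j i h).symm
  · intro i
    refine ⟨(hmeas.comp (measurable_nextInput.iterate i)).aemeasurable, hmeas.aemeasurable, ?_⟩
    change (systemLaw lam G).map ((f ∘ firstPacket) ∘ nextInput^[i]) = _
    rw [← Measure.map_map hmeas (measurable_nextInput.iterate i), (hmp.iterate i).map_eq]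
    rfl


end

/-! ### Long-run averages over the admitted packets. -/

section

variable {N : ℕ} {lam : Fin (N + 1) → ℝ} {G : Fin (N + 1) → Measure ℝ}
  [∀ n, IsProbabilityMeasure (G n)]

lemma sum_lam_div_mul (lam : Fin (N + 1) → ℝ) (y : Fin (N + 1) → ℝ) :
    ∑ n, lam n / (∑ k, lam k) * y n = (∑ n, lam n * y n) / ∑ k, lam k := by
  rw [Finset.sum_div]
  exact Finset.sum_congr rfl fun n _ => by ring

lemma tendsto_average_idle (hlam : ∀ n, 0 < lam n) (hG : ∀ n, ∀ᵐ s ∂G n, 0 ≤ s) :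
    ∀ᵐ W ∂systemLaw lam G, Tendsto (fun m : ℕ =>
      (∑ i ∈ Finset.range m, (firstPacket (nextInput^[i] W)).2.1) / m) atTop
      (𝓝 (1 / ∑ k, lam k)) := by
  have hs := sum_lam_pos hlam
  have := isProbabilityMeasure_expMeasure hs
  have hf : Measurable fun z : Fin (N + 1) × (ℝ × ℝ) => z.2.1 := by fun_prop
  have hint : ∀ n, Integrable (fun z : ℝ × ℝ => z.1) ((expMeasure (∑ k, lam k)).prod (G n)) :=
    fun n => (integrable_id_expMeasure hs).comp_fst (G n)
  have hmean : ∫ z, z.2.1 ∂packetLaw lam G = 1 / ∑ k, lam k := by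
    rw [integral_packetLaw hlam hf hint]
    have : ∀ n, ∫ z : ℝ × ℝ, z.1 ∂(expMeasure (∑ k, lam k)).prod (G n) = 1 / ∑ k, lam k := by
      intro n
      rw [integral_fun_fst (f := fun a : ℝ => a), integral_id_expMeasure hs]
      simp
    simp only [this]
    rw [← Finset.sum_mul, ← Finset.sum_div, div_self hs.ne', one_mul]
  rw [← hmean]
  have hlim := tendsto_average_firstPacket hlam hG hf (integrable_packetLaw hf hint)
  exact hlim

lemma tendsto_average_service (hlam : ∀ n, 0 < lam n) (hG : ∀ n, ∀ᵐ s ∂G n, 0 ≤ s)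
    (hmean : ∀ n, Integrable (fun s : ℝ => s) (G n)) :
    ∀ᵐ W ∂systemLaw lam G, Tendsto (fun m : ℕ =>
      (∑ i ∈ Finset.range m, (firstPacket (nextInput^[i] W)).2.2) / m) atTop
      (𝓝 ((∑ n, lam n * ∫ s, s ∂G n) / ∑ k, lam k)) := by
  have hs := sum_lam_pos hlam
  have := isProbabilityMeasure_expMeasure hs
  have hf : Measurable fun z : Fin (N + 1) × (ℝ × ℝ) => z.2.2 := by fun_prop
  have hint : ∀ n, Integrable (fun z : ℝ × ℝ => z.2) ((expMeasure (∑ k, lam k)).prod (G n)) :=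
    fun n => (hmean n).comp_snd _
  have hval : ∫ z, z.2.2 ∂packetLaw lam G = (∑ n, lam n * ∫ s, s ∂G n) / ∑ k, lam k := by
    rw [integral_packetLaw hlam hf hint, ← sum_lam_div_mul]
    refine Finset.sum_congr rfl fun n _ => ?_
    rw [integral_fun_snd (f := fun a : ℝ => a)]
    simp
  rw [← hval]
  have hlim := tendsto_average_firstPacket hlam hG hf (integrable_packetLaw hf hint)
  exact hlim

lemma tendsto_average_class (hlam : ∀ n, 0 < lam n) (hG : ∀ n, ∀ᵐ s ∂G n, 0 ≤ s)
    (n : Fin (N + 1)) :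
    ∀ᵐ W ∂systemLaw lam G, Tendsto (fun m : ℕ =>
      (∑ i ∈ Finset.range m, if (firstPacket (nextInput^[i] W)).1 = n then (1 : ℝ) else 0) / m)
      atTop (𝓝 (lam n / ∑ k, lam k)) := by
  have hs := sum_lam_pos hlam
  have := isProbabilityMeasure_expMeasure hs
  have hf : Measurable fun z : Fin (N + 1) × (ℝ × ℝ) => if z.1 = n then (1 : ℝ) else 0 :=
    Measurable.ite (measurable_fst (measurableSet_singleton n)) measurable_const measurable_const
  have hint : ∀ k, Integrable (fun _ : ℝ × ℝ => if k = n then (1 : ℝ) else 0)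
      ((expMeasure (∑ k, lam k)).prod (G k)) := fun k => integrable_const _
  have hval : ∫ z, (if z.1 = n then (1 : ℝ) else 0) ∂packetLaw lam G = lam n / ∑ k, lam k := by
    rw [integral_packetLaw hlam hf hint, Finset.sum_eq_single n]
    · simp
    · intro k _ hk
      simp [hk]
    · simp
  rw [← hval]
  have hlim := tendsto_average_firstPacket hlam hG hf (integrable_packetLaw hf hint)
  exact hlim

lemma tendsto_average_class_service (hlam : ∀ n, 0 < lam n) (hG : ∀ n, ∀ᵐ s ∂G n, 0 ≤ s)
    (hmean : ∀ n, Integrable (fun s : ℝ => s) (G n)) (n : Fin (N + 1)) :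
    ∀ᵐ W ∂systemLaw lam G, Tendsto (fun m : ℕ =>
      (∑ i ∈ Finset.range m, if (firstPacket (nextInput^[i] W)).1 = n then
        (firstPacket (nextInput^[i] W)).2.2 else 0) / m)
      atTop (𝓝 (lam n * (∫ s, s ∂G n) / ∑ k, lam k)) := by
  have hs := sum_lam_pos hlam
  have := isProbabilityMeasure_expMeasure hs
  have hf : Measurable fun z : Fin (N + 1) × (ℝ × ℝ) => if z.1 = n then z.2.2 else 0 :=
    Measurable.ite (measurable_fst (measurableSet_singleton n)) (by fun_prop) measurable_const
  have hint : ∀ k, Integrable (fun z : ℝ × ℝ => if k = n then z.2 else 0)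
      ((expMeasure (∑ k, lam k)).prod (G k)) := fun k => by
    by_cases h : k = n
    · simp only [h, if_true]
      exact (hmean n).comp_snd _
    · simp only [h, if_false]
      exact integrable_const _
  have hval : ∫ z, (if z.1 = n then z.2.2 else 0) ∂packetLaw lam G =
      lam n * (∫ s, s ∂G n) / ∑ k, lam k := by
    rw [integral_packetLaw hlam hf hint, Finset.sum_eq_single n]
    · simp only [if_true]
      rw [integral_fun_snd (f := fun a : ℝ => a)]
      simp only [probReal_univ, one_smul]
      ring
    · intro k _ hk
      simp [hk]
    · simp
  rw [← hval]
  have hlim := tendsto_average_firstPacket hlam hG hf (integrable_packetLaw hf hint)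
  exact hlim

end

/-! ### Pathwise description of the admitted packets. -/

/-- A realization without simultaneous events in which finitely many packets arrive in finite
time. -/
structure IsRegular {N : ℕ} (T S : Fin N → ℕ → ℝ) : Prop where
  pos : ∀ n i, 0 < T n i
  strictMono : ∀ n, StrictMono (T n)
  service_nonneg : ∀ n i, 0 ≤ S n i
  finite_le : ∀ t, {q : Fin N × ℕ | T q.1 q.2 ≤ t}.Finite
  injective : ∀ p q : Fin N × ℕ, T p.1 p.2 = T q.1 q.2 → p = q
  departure_ne : ∀ p q : Fin N × ℕ, p ≠ q → T q.1 q.2 + S q.1 q.2 ≠ T p.1 p.2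

/-- The set of admitted packets is determined by the realization. -/
lemma IsAdmitted.unique {N : ℕ} {T S : Fin N → ℕ → ℝ}
    (hfin : ∀ t, {q : Fin N × ℕ | T q.1 q.2 ≤ t}.Finite) {A B : Set (Fin N × ℕ)}
    (hA : IsAdmitted T S A) (hB : IsAdmitted T S B) : A = B := by
  -- Only finitely many packets arrive before a given time, so induction on the arrival time is
  -- legitimate. The admission rule refers only to strictly earlier packets.
  have hwf : WellFounded fun q p : Fin N × ℕ => T q.1 q.2 < T p.1 p.2 := by
    rw [WellFounded.wellFounded_iff_has_min]
    rintro s ⟨a, ha⟩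
    obtain ⟨m, hm, hmin⟩ := Set.exists_min_image (s ∩ {q | T q.1 q.2 ≤ T a.1 a.2})
      (fun q => T q.1 q.2) ((hfin _).inter_of_right s) ⟨a, ha, le_refl (T a.1 a.2)⟩
    refine ⟨m, hm.1, fun x hx hlt => ?_⟩
    exact absurd (hmin x ⟨hx, hlt.le.trans hm.2⟩) (not_le.2 hlt)
  ext p
  induction p using hwf.induction with
  | _ p ih =>
    rw [hA p, hB p]
    constructor
    · exact fun h q hq hlt => h q ((ih q hlt).2 hq) hlt
    · exact fun h q hq hlt => h q ((ih q hlt).1 hq) hlt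

/-- `p m` is the `m`-th admitted packet and the server becomes idle for the `m`-th time at time
`R m`. -/
structure IsAdmissionSeq {N : ℕ} (T S : Fin N → ℕ → ℝ) (p : ℕ → Fin N × ℕ) (R : ℕ → ℝ) :
    Prop where
  zero : R 0 = 0
  lt_arrival : ∀ m, R m < T (p m).1 (p m).2
  arrival_le : ∀ m (q : Fin N × ℕ), R m < T q.1 q.2 → T (p m).1 (p m).2 ≤ T q.1 q.2
  succ : ∀ m, R (m + 1) = T (p m).1 (p m).2 + S (p m).1 (p m).2

namespace IsAdmissionSeq

variable {N : ℕ} {T S : Fin N → ℕ → ℝ} {p : ℕ → Fin N × ℕ} {R : ℕ → ℝ}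

lemma monotone (h : IsAdmissionSeq T S p R) (hreg : IsRegular T S) : Monotone R :=
  monotone_nat_of_le_succ fun m => by
    rw [h.succ]
    linarith [h.lt_arrival m, hreg.service_nonneg (p m).1 (p m).2]

lemma departure_lt (h : IsAdmissionSeq T S p R) (hreg : IsRegular T S) {l m : ℕ} (hlm : l < m) :
    T (p l).1 (p l).2 + S (p l).1 (p l).2 < T (p m).1 (p m).2 := by
  rw [← h.succ]
  exact (h.monotone hreg hlm).trans_lt (h.lt_arrival m)

lemma strictMono (h : IsAdmissionSeq T S p R) (hreg : IsRegular T S) :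
    StrictMono fun m => T (p m).1 (p m).2 := fun l m hlm => by
  linarith [h.departure_lt hreg hlm, hreg.service_nonneg (p l).1 (p l).2]

/-- The packets `p m` are distinct, and only finitely many arrive up to time `t`, so the times `R m`
cannot stay bounded. -/
lemma exists_le (h : IsAdmissionSeq T S p R) (hreg : IsRegular T S) (t : ℝ) : ∃ m, t ≤ R m := by
  by_contra! hlt
  have hinj : Function.Injective p := fun l m hlm =>
    (h.strictMono hreg).injective (by simp only [hlm])
  refine Set.infinite_range_of_injective hinj ((hreg.finite_le t).subset ?_)
  rintro _ ⟨m, rfl⟩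
  have := hlt (m + 1)
  rw [h.succ] at this
  change T (p m).1 (p m).2 ≤ t
  linarith [hreg.service_nonneg (p m).1 (p m).2]

/-- Every packet is one of the sequence or arrives during the service of one of the sequence. -/
lemma eq_or_busy (h : IsAdmissionSeq T S p R) (hreg : IsRegular T S) (q : Fin N × ℕ) :
    ∃ m, q = p m ∨ (T (p m).1 (p m).2 < T q.1 q.2 ∧
      T q.1 q.2 < T (p m).1 (p m).2 + S (p m).1 (p m).2) := by
  classical
  have hex := h.exists_le hreg (T q.1 q.2)
  obtain ⟨m, hm⟩ : ∃ m, Nat.find hex = m + 1 := Nat.exists_eq_succ_of_ne_zero fun h0 => by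
    have := Nat.find_spec hex
    rw [h0, h.zero] at this
    exact absurd (hreg.pos q.1 q.2) (not_lt.2 this)
  have h1 : T q.1 q.2 ≤ R (m + 1) := hm ▸ Nat.find_spec hex
  have h2 : R m < T q.1 q.2 := not_le.1 (Nat.find_min hex (by omega))
  refine ⟨m, ?_⟩
  by_cases hq : q = p m
  · exact Or.inl hq
  · refine Or.inr ⟨lt_of_le_of_ne (h.arrival_le m q h2) fun he => hq (hreg.injective _ _ he).symm,
      lt_of_le_of_ne (h.succ m ▸ h1) fun he => hreg.departure_ne q (p m) hq he.symm⟩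

lemma isAdmitted (h : IsAdmissionSeq T S p R) (hreg : IsRegular T S) :
    IsAdmitted T S (Set.range p) := by
  intro q
  constructor
  · rintro ⟨m, rfl⟩ _ ⟨l, rfl⟩ hlt
    exact (h.departure_lt hreg ((h.strictMono hreg).lt_iff_lt.1 hlt)).le
  · intro hq
    obtain ⟨m, hm | hm⟩ := h.eq_or_busy hreg q
    · exact ⟨m, hm.symm⟩
    · exact absurd (hq (p m) ⟨m, rfl⟩ hm.1) (not_le.2 hm.2)

/-- Time up to the `m`-th return to idleness splits into idle periods and services, the two
quantities whose averages the strong law supplies. -/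
lemma eq_sum (h : IsAdmissionSeq T S p R) (m : ℕ) :
    R m = ∑ l ∈ Finset.range m, (T (p l).1 (p l).2 - R l) +
      ∑ l ∈ Finset.range m, S (p l).1 (p l).2 := by
  induction m with
  | zero => simp [h.zero]
  | succ m ih =>
    rw [h.succ, Finset.sum_range_succ, Finset.sum_range_succ]
    linarith

lemma infinite_class (h : IsAdmissionSeq T S p R) (hreg : IsRegular T S) {n : Fin N}
    (hinf : {m | (p m).1 = n}.Infinite) : {i | (n, i) ∈ Set.range p}.Infinite := by
  have hinj : Function.Injective p := fun l m hlm =>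
    (h.strictMono hreg).injective (by simp only [hlm])
  have : (fun m => (p m).2) '' {m | (p m).1 = n} ⊆ {i | (n, i) ∈ Set.range p} := by
    rintro _ ⟨m, hm, rfl⟩
    exact ⟨m, Prod.ext hm rfl⟩
  refine (hinf.image ?_).mono this
  intro l hl m hm hlm
  exact hinj (Prod.ext ((show (p l).1 = n from hl).trans (show (p m).1 = n from hm).symm) hlm)

/-- The `k`-th admitted packet of class `n` in terms of the sequence of admitted packets. -/
lemma nth_eq (h : IsAdmissionSeq T S p R) (hreg : IsRegular T S) {n : Fin N}
    (hinf : {m | (p m).1 = n}.Infinite) (k : ℕ) :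
    p (Nat.nth (fun m => (p m).1 = n) k) = (n, Nat.nth (fun i => (n, i) ∈ Set.range p) k) := by
  have hinf' := h.infinite_class hreg hinf
  have hc : ∀ k, (p (Nat.nth (fun m => (p m).1 = n) k)).1 = n := fun k =>
    Nat.nth_mem_of_infinite hinf k
  have hmono : StrictMono fun k => (p (Nat.nth (fun m => (p m).1 = n) k)).2 := by
    intro j k hjk
    have := h.strictMono hreg (Nat.nth_strictMono hinf hjk)
    simp only [hc] at this
    exact (hreg.strictMono n).lt_iff_lt.1 this
  -- Two strictly increasing sequences of naturals with the same range coincide.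
  have heq := (hmono.range_inj (Nat.nth_strictMono hinf')).1 (by
    rw [Nat.range_nth_of_infinite hinf']
    ext i
    constructor
    · rintro ⟨k, rfl⟩
      exact ⟨_, Prod.ext (hc k) rfl⟩
    · rintro ⟨m, hm⟩
      have hmn : (p m).1 = n := by rw [hm]
      obtain ⟨k, hk⟩ : m ∈ Set.range (Nat.nth fun m => (p m).1 = n) := by
        rw [Nat.range_nth_of_infinite hinf]
        exact hmn
      exact ⟨k, by simp only [hk, hm]⟩)
  exact Prod.ext (hc k) (congrFun heq k)

end IsAdmissionSeq

/-! ### The peaks of the age on one realization. -/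

section Peak

variable {N : ℕ} {T S : Fin N → ℕ → ℝ} {Adm : Set (Fin N × ℕ)} {n : Fin N}

/-- Admission gives the weak inequality; it is strict because in a regular realization no departure
coincides with another packet's arrival. -/
lemma departure_lt_nth_succ (hreg : IsRegular T S) (hadm : IsAdmitted T S Adm)
    (hinf : {i | (n, i) ∈ Adm}.Infinite) (k : ℕ) :
    receptionTime T S Adm n k < T n (Nat.nth (fun i => (n, i) ∈ Adm) (k + 1)) := by
  have hlt := Nat.nth_strictMono hinf k.lt_succ_self
  refine lt_of_le_of_ne ((hadm (n, _)).1 (Nat.nth_mem_of_infinite hinf (k + 1)) (n, _)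
    (Nat.nth_mem_of_infinite hinf k) (hreg.strictMono n hlt)) ?_
  refine hreg.departure_ne (n, _) (n, _) fun he => ?_
  exact hlt.ne' (Prod.ext_iff.1 he).2

lemma strictMono_receptionTime (hreg : IsRegular T S) (hadm : IsAdmitted T S Adm)
    (hinf : {i | (n, i) ∈ Adm}.Infinite) : StrictMono (receptionTime T S Adm n) :=
  strictMono_nat_of_lt_succ fun k => by
    have := departure_lt_nth_succ hreg hadm hinf k
    rw [receptionTime.eq_1 T S Adm n (k + 1)]
    linarith [hreg.service_nonneg n (Nat.nth (fun i => (n, i) ∈ Adm) (k + 1))]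

lemma peakAge_of_lastGeneration {a₀ u g : ℝ} {k : ℕ} (hu : u < receptionTime T S Adm n k)
    (hg : ∀ t, u ≤ t → t < receptionTime T S Adm n k → lastGeneration T S Adm a₀ n t = g) :
    peakAge T S Adm a₀ n k = receptionTime T S Adm n k - g := by
  refine leftLim_eq_of_tendsto ?_
  have h : Tendsto (fun t : ℝ => t - g) (𝓝[<] (receptionTime T S Adm n k))
      (𝓝 (receptionTime T S Adm n k - g)) :=
    ((continuous_id.sub continuous_const).tendsto _).mono_left nhdsWithin_le_nhds
  refine h.congr' ?_
  filter_upwards [Ioo_mem_nhdsLT hu] with t ht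
  rw [age, hg t ht.1.le ht.2]

lemma peakAge_zero (hreg : IsRegular T S) (hadm : IsAdmitted T S Adm)
    (hinf : {i | (n, i) ∈ Adm}.Infinite) (a₀ : ℝ) :
    peakAge T S Adm a₀ n 0 = receptionTime T S Adm n 0 + a₀ := by
  rw [peakAge_of_lastGeneration (u := receptionTime T S Adm n 0 - 1) (g := -a₀) (by linarith),
    sub_neg_eq_add]
  intro t _ ht
  have : {u | ∃ i, (n, i) ∈ Adm ∧ T n i + S n i ≤ t ∧ u = T n i} = ∅ := by
    rw [Set.eq_empty_iff_forall_notMem]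
    rintro _ ⟨i, hi, hle, -⟩
    obtain ⟨j, rfl⟩ : i ∈ Set.range (Nat.nth fun i => (n, i) ∈ Adm) := by
      rw [Nat.range_nth_of_infinite hinf]
      exact hi
    have := (strictMono_receptionTime hreg hadm hinf).monotone (Nat.zero_le j)
    exact absurd (hle.trans_lt ht) (not_lt.2 this)
  rw [lastGeneration, this]
  simp

/-- Between consecutive receptions the newest information is the packet received last, since class-n
packets are received in order of generation. The assumption on `a₀` keeps the initial information
older than every packet. -/
lemma peakAge_succ (hreg : IsRegular T S) (hadm : IsAdmitted T S Adm)
    (hinf : {i | (n, i) ∈ Adm}.Infinite) {a₀ : ℝ} (ha₀ : 0 ≤ a₀) (k : ℕ) :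
    peakAge T S Adm a₀ n (k + 1) =
      receptionTime T S Adm n (k + 1) - T n (Nat.nth (fun i => (n, i) ∈ Adm) k) := by
  have hmono := strictMono_receptionTime hreg hadm hinf
  refine peakAge_of_lastGeneration (hmono k.lt_succ_self) fun t ht1 ht2 => ?_
  refine IsGreatest.csSup_eq ⟨Or.inr ⟨_, Nat.nth_mem_of_infinite hinf k, ht1, rfl⟩, ?_⟩
  rintro _ (rfl | ⟨i, hi, hle, rfl⟩)
  · linarith [hreg.pos n (Nat.nth (fun i => (n, i) ∈ Adm) k)]
  · obtain ⟨j, rfl⟩ : i ∈ Set.range (Nat.nth fun i => (n, i) ∈ Adm) := by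
      rw [Nat.range_nth_of_infinite hinf]
      exact hi
    have hj : j < k + 1 := hmono.lt_iff_lt.1 (hle.trans_lt ht2)
    exact (hreg.strictMono n).monotone ((Nat.nth_strictMono hinf).monotone (Nat.le_of_lt_succ hj))

/-- The peaks telescope. -/
lemma sum_peakAge (hreg : IsRegular T S) (hadm : IsAdmitted T S Adm)
    (hinf : {i | (n, i) ∈ Adm}.Infinite) {a₀ : ℝ} (ha₀ : 0 ≤ a₀) (K : ℕ) :
    ∑ k ∈ Finset.range (K + 1), peakAge T S Adm a₀ n k =
      receptionTime T S Adm n K +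
        ∑ k ∈ Finset.range K, S n (Nat.nth (fun i => (n, i) ∈ Adm) k) + a₀ := by
  induction K with
  | zero => simp [peakAge_zero hreg hadm hinf]
  | succ K ih =>
    rw [Finset.sum_range_succ, ih, peakAge_succ hreg hadm hinf ha₀, Finset.sum_range_succ,
      receptionTime.eq_1 T S Adm n K]
    ring

end Peak

/-! ### From averages over all admitted packets to the peak age. -/

/-- This converts sums over the packets of one class into sums over all admitted packets, to which
the strong law applies. -/
lemma sum_range_nth_ite {P : ℕ → Prop} [DecidablePred P] (hP : {m | P m}.Infinite) (f : ℕ → ℝ)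
    (K : ℕ) : (∑ l ∈ Finset.range (Nat.nth P K), if P l then f l else 0) =
      ∑ k ∈ Finset.range K, f (Nat.nth P k) := by
  rw [← Finset.sum_filter]
  induction K with
  | zero =>
    rw [Finset.range_zero, Finset.sum_empty]
    refine Finset.sum_eq_zero fun l hl => ?_
    rw [Finset.mem_filter, Finset.mem_range] at hl
    have := (Nat.nth_strictMono (p := P) hP).monotone (Nat.zero_le (Nat.count P l))
    rw [Nat.nth_count hl.2] at this
    omega
  | succ K ih =>
    rw [Nat.filter_range_nth_eq_insert_of_infinite hP, Finset.sum_insert (by simp), ih,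
      Finset.sum_range_succ, add_comm]

/-- The peak age of information from the long-run averages over all admitted packets. -/
lemma hasPAoI_of_averages {N : ℕ} {T S : Fin N → ℕ → ℝ} {p : ℕ → Fin N × ℕ} {R : ℕ → ℝ}
    (hreg : IsRegular T S) (h : IsAdmissionSeq T S p R) {n : Fin N} {a₀ : ℝ} (ha₀ : 0 ≤ a₀)
    {c r v : ℝ} (hc : 0 < c)
    (hC : Tendsto (fun m : ℕ => (∑ l ∈ Finset.range m, if (p l).1 = n then (1 : ℝ) else 0) / m)
      atTop (𝓝 c))
    (hR : Tendsto (fun m : ℕ => R m / m) atTop (𝓝 r))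
    (hV : Tendsto (fun m : ℕ => (∑ l ∈ Finset.range m,
      if (p l).1 = n then S (p l).1 (p l).2 else 0) / m) atTop (𝓝 v)) :
    HasPAoI T S (Set.range p) a₀ n (r / c + v / c) := by
  -- A class with finitely many admitted packets would have frequency 0, contradicting `0 < c`.
  have hinf : {m | (p m).1 = n}.Infinite := by
    intro hfin
    have hbound : ∀ m, (∑ l ∈ Finset.range m, if (p l).1 = n then (1 : ℝ) else 0) ≤
        hfin.toFinset.card := fun m => by
      rw [Finset.sum_boole]
      exact_mod_cast Finset.card_le_card fun l hl => by simpa using (Finset.mem_filter.1 hl).2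
    have h0 : Tendsto (fun m : ℕ => (∑ l ∈ Finset.range m, if (p l).1 = n then (1 : ℝ) else 0) / m)
        atTop (𝓝 0) := by
      refine squeeze_zero (fun m => div_nonneg (Finset.sum_nonneg fun l _ => by positivity)
        m.cast_nonneg) (fun m => div_le_div_of_nonneg_right (hbound m) m.cast_nonneg)
        (tendsto_const_div_atTop_nhds_zero_nat _)
    exact hc.ne' (tendsto_nhds_unique hC h0)
  have hinf' := h.infinite_class hreg hinf
  refine ⟨hinf', ?_⟩
  set M : ℕ → ℕ := Nat.nth fun m => (p m).1 = n with hM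
  have hMmono : StrictMono M := Nat.nth_strictMono hinf
  have hMtop : Tendsto M atTop atTop := hMmono.tendsto_atTop
  have hM1top : Tendsto (fun K => M K + 1) atTop atTop := (tendsto_add_atTop_nat 1).comp hMtop
  have hcount : ∀ K, (∑ l ∈ Finset.range (M K), if (p l).1 = n then (1 : ℝ) else 0) = K := fun K => by
    rw [sum_range_nth_ite hinf (fun _ => 1) K]
    simp
  have hcount1 : ∀ K, (∑ l ∈ Finset.range (M K + 1), if (p l).1 = n then (1 : ℝ) else 0) =
      (K : ℝ) + 1 := fun K => by
    rw [Finset.sum_range_succ, hcount, if_pos (Nat.nth_mem_of_infinite hinf K)]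
  have hserv : ∀ k, S (p (M k)).1 (p (M k)).2 =
      S n (Nat.nth (fun i => (n, i) ∈ Set.range p) k) := fun k => by
    rw [hM, h.nth_eq hreg hinf k]
  have hrec : ∀ K, receptionTime T S (Set.range p) n K = R (M K + 1) := fun K => by
    rw [h.succ, hM, h.nth_eq hreg hinf K]
    rfl
  -- The reception of the `K`-th class-n packet is counted in `R`, hence the index `M K + 1`, while
  -- its service time is not in the second sum, hence `M K`. The correction `lim3` reconciles the
  -- two normalizations.
  have hsum : ∀ K : ℕ, ∑ k ∈ Finset.range (K + 1), peakAge T S (Set.range p) a₀ n k =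
      R (M K + 1) + (∑ l ∈ Finset.range (M K), if (p l).1 = n then S (p l).1 (p l).2 else 0) +
        a₀ := fun K => by
    rw [sum_peakAge hreg (h.isAdmitted hreg) hinf' ha₀, hrec,
      sum_range_nth_ite hinf (fun l => S (p l).1 (p l).2) K]
    simp only [← hM, hserv]
  have lim1 : Tendsto (fun K : ℕ => R (M K + 1) / ((K : ℝ) + 1)) atTop (𝓝 (r / c)) := by
    refine ((hR.comp hM1top).div (hC.comp hM1top) hc.ne').congr fun K => ?_
    simp only [Pi.div_apply, Function.comp_apply, hcount1]
    have : ((M K + 1 : ℕ) : ℝ) ≠ 0 := by positivity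
    rw [div_div_div_cancel_right₀ this]
  have lim2 : Tendsto (fun K : ℕ => (∑ l ∈ Finset.range (M K),
      if (p l).1 = n then S (p l).1 (p l).2 else 0) / (K : ℝ)) atTop (𝓝 (v / c)) := by
    refine ((hV.comp hMtop).div (hC.comp hMtop) hc.ne').congr' ?_
    filter_upwards [hMtop.eventually_ne_atTop 0] with K hK
    simp only [Pi.div_apply, Function.comp_apply, hcount]
    rw [div_div_div_cancel_right₀ (by exact_mod_cast hK)]
  have lim3 : Tendsto (fun K : ℕ => (K : ℝ) / ((K : ℝ) + 1)) atTop (𝓝 1) :=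
    tendsto_natCast_div_add_atTop 1
  have lim4 : Tendsto (fun K : ℕ => a₀ / ((K : ℝ) + 1)) atTop (𝓝 0) := by
    have := (tendsto_const_div_atTop_nhds_zero_nat a₀).comp (tendsto_add_atTop_nat 1)
    refine this.congr fun K => ?_
    simp
  rw [← tendsto_add_atTop_iff_nat 1]
  have := (lim1.add (lim2.mul lim3)).add lim4
  rw [mul_one, add_zero] at this
  refine this.congr' ?_
  filter_upwards [eventually_ne_atTop 0] with K hK
  have hK' : (K : ℝ) ≠ 0 := by exact_mod_cast hK
  have hK1 : (K : ℝ) + 1 ≠ 0 := by positivity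
  rw [hsum, Nat.cast_add, Nat.cast_one, div_mul_div_cancel₀ hK']
  field_simp

/-! ### The iterates of `nextInput` generate the admitted packets. -/

section Path

variable {N : ℕ} {W : Fin (N + 1) → PacketStream}

/-- The realization of the system described by the input streams `W` is regular. -/
abbrev IsRegularInput {N : ℕ} (W : Fin N → PacketStream) : Prop :=
  IsRegular (fun n => (W n).arrival) fun n i => (W n i).2

/-- The time at which the server becomes idle for the `m`-th time. -/
def idleTime (W : Fin (N + 1) → PacketStream) : ℕ → ℝ
  | 0 => 0
  | m + 1 => idleTime W m + firstDeparture (nextInput^[m] W)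

/-- The label of the `m`-th admitted packet. -/
def admittedPacket (W : Fin (N + 1) → PacketStream) (m : ℕ) : Fin (N + 1) × ℕ :=
  (firstClass (nextInput^[m] W),
    firstAfter (idleTime W m) (W (firstClass (nextInput^[m] W))))

lemma IsRegular.unbounded (h : IsRegularInput W) (n : Fin (N + 1)) : (W n).Unbounded := by
  intro r
  by_contra! hle
  refine Set.infinite_range_of_injective (Prod.mk_right_injective n)
    ((h.finite_le r).subset ?_)
  rintro _ ⟨i, rfl⟩
  exact hle i

lemma IsRegular.exists_isFirst_shift (h : IsRegularInput W) (r : ℝ) :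
    ∃ n, IsFirst n fun k => shift r (W k) := by
  obtain ⟨n, hn⟩ := Finite.exists_min fun k => (shift r (W k) 0).1
  refine ⟨n, fun k hk => lt_of_le_of_ne (hn k) fun he => hk ?_⟩
  simp only [← arrival_zero, arrival_shift, add_zero, sub_left_inj] at he
  exact (Prod.ext_iff.1 (h.injective (n, _) (k, _) he)).1.symm

lemma firstPacket_shift (r : ℝ) (W : Fin (N + 1) → PacketStream) {n : Fin (N + 1)}
    (hn : firstClass (fun k => shift r (W k)) = n) :
    firstPacket (fun k => shift r (W k)) =
      (n, ((W n).arrival (firstAfter r (W n)) - r, (W n (firstAfter r (W n))).2)) := by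
  simp only [firstPacket, hn]
  refine Prod.ext rfl (Prod.ext ?_ ?_)
  · simp only [← arrival_zero, arrival_shift, add_zero]
  · simp only [shift_snd, add_zero]

lemma IsRegular.firstDeparture_shift_nonneg (h : IsRegularInput W) (r : ℝ) :
    0 ≤ firstDeparture fun k => shift r (W k) := by
  rw [firstDeparture, firstPacket_shift r W rfl]
  set n := firstClass fun k => shift r (W k)
  have h1 := (h.unbounded n).lt_arrival_firstAfter r
  have h2 := h.service_nonneg n (firstAfter r (W n))
  simp only at h2 ⊢
  linarith

/-- Successive shifts compose into one shift by the total elapsed time; composing them requires each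
departure time to be nonnegative. The base case uses that all arrivals are strictly after time 0. -/
lemma IsRegular.iterate_nextInput (h : IsRegularInput W) (m : ℕ) :
    nextInput^[m] W = fun k => shift (idleTime W m) (W k) := by
  induction m with
  | zero =>
    funext k
    have hJ : firstAfter 0 (W k) = 0 := firstAfter_eq_of (h.pos k 0) (by simp)
    apply eq_of_arrival_eq
    · intro i
      simp [idleTime, arrival_shift, hJ]
    · intro i
      simp [idleTime, shift_snd, hJ]
  | succ m ih =>
    rw [Function.iterate_succ_apply', idleTime, ih]
    funext k
    exact shift_shift (h.unbounded k) (h.firstDeparture_shift_nonneg _)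

lemma IsRegular.firstPacket_iterate (h : IsRegularInput W) (m : ℕ) :
    firstPacket (nextInput^[m] W) = ((admittedPacket W m).1,
      ((W (admittedPacket W m).1).arrival (admittedPacket W m).2 - idleTime W m,
        (W (admittedPacket W m).1 (admittedPacket W m).2).2)) := by
  have h1 := h.iterate_nextInput m
  conv_lhs => rw [h1]
  exact firstPacket_shift _ _ (by rw [← h1]; rfl)

lemma IsRegular.isAdmissionSeq (h : IsRegularInput W) :
    IsAdmissionSeq (fun n => (W n).arrival) (fun n i => (W n i).2) (admittedPacket W)
      (idleTime W) where
  zero := rfl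
  lt_arrival m := (h.unbounded _).lt_arrival_firstAfter _
  arrival_le m q hq := by
    obtain ⟨n, hn⟩ := h.exists_isFirst_shift (idleTime W m)
    have hc : firstClass (nextInput^[m] W) = n := by
      rw [h.iterate_nextInput]
      exact hn.firstClass_eq
    have hle : firstAfter (idleTime W m) (W q.1) ≤ q.2 := Nat.sInf_le hq
    refine le_trans ?_ ((h.strictMono q.1).monotone hle)
    simp only [admittedPacket, hc]
    by_cases hqn : q.1 = n
    · rw [hqn]
    · have := hn q.1 hqn
      simp only [← arrival_zero, arrival_shift, add_zero, sub_lt_sub_iff_right] at this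
      exact this.le
  succ m := by
    rw [idleTime, firstDeparture, h.firstPacket_iterate]
    ring

/-- The peak age of information of a regular realization whose admitted packets have the right
long-run averages. -/
lemma IsRegular.hasPAoI (h : IsRegularInput W) {lam x : Fin (N + 1) → ℝ} (hlam : ∀ n, 0 < lam n)
    {n : Fin (N + 1)}
    (hidle : Tendsto (fun m : ℕ =>
      (∑ i ∈ Finset.range m, (firstPacket (nextInput^[i] W)).2.1) / m) atTop
      (𝓝 (1 / ∑ k, lam k)))
    (hserv : Tendsto (fun m : ℕ =>
      (∑ i ∈ Finset.range m, (firstPacket (nextInput^[i] W)).2.2) / m) atTop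
      (𝓝 ((∑ k, lam k * x k) / ∑ k, lam k)))
    (hclass : Tendsto (fun m : ℕ =>
      (∑ i ∈ Finset.range m, if (firstPacket (nextInput^[i] W)).1 = n then (1 : ℝ) else 0) / m)
      atTop (𝓝 (lam n / ∑ k, lam k)))
    (hboth : Tendsto (fun m : ℕ =>
      (∑ i ∈ Finset.range m, if (firstPacket (nextInput^[i] W)).1 = n then
        (firstPacket (nextInput^[i] W)).2.2 else 0) / m)
      atTop (𝓝 (lam n * x n / ∑ k, lam k)))
    {a₀ : ℝ} (ha₀ : 0 ≤ a₀) :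
    HasPAoI (fun n => (W n).arrival) (fun n i => (W n i).2) (Set.range (admittedPacket W)) a₀ n
      (x n + 1 / lam n + (∑ k, lam k * x k) / lam n) := by
  have hs := sum_lam_pos hlam
  simp only [h.firstPacket_iterate] at hidle hserv hclass hboth
  have hR : Tendsto (fun m : ℕ => idleTime W m / m) atTop
      (𝓝 (1 / ∑ k, lam k + (∑ k, lam k * x k) / ∑ k, lam k)) := by
    refine (hidle.add hserv).congr fun m => ?_
    rw [← add_div]
    exact congrArg (· / (m : ℝ)) (h.isAdmissionSeq.eq_sum m).symm
  have := hasPAoI_of_averages h h.isAdmissionSeq ha₀ (div_pos (hlam n) hs) hclass hR hboth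
  convert this using 1
  have := (hlam n).ne'
  field_simp
  ring

/-- Within one class, `hne` is asked only against earlier packets: an arrival cannot equal the
departure of a later packet because arrivals increase and services are nonnegative. -/
lemma isRegularInput_of {N : ℕ} {W : Fin N → PacketStream} (hpos : ∀ n i, 0 < (W n i).1)
    (hnonneg : ∀ n i, 0 ≤ (W n i).2) (hunb : ∀ n, (W n).Unbounded)
    (hne : ∀ p q : Fin N × ℕ, (p.1 = q.1 → q.2 < p.2) →
      (W p.1).arrival p.2 ≠ (W q.1).arrival q.2 ∧
      (W p.1).arrival p.2 ≠ (W q.1).arrival q.2 + (W q.1 q.2).2) : IsRegularInput W where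
  pos n i := by
    have := (strictMono_arrival (hpos n)).monotone (Nat.zero_le i)
    rw [arrival_zero] at this
    exact (hpos n 0).trans_le this
  strictMono n := strictMono_arrival (hpos n)
  service_nonneg := hnonneg
  finite_le t := by
    choose j hj using fun n => hunb n t
    refine (Set.finite_iUnion fun n => (Set.finite_Iio (j n)).image (Prod.mk n)).subset ?_
    rintro ⟨n, i⟩ hi
    refine Set.mem_iUnion.2 ⟨n, i, ?_, rfl⟩
    exact (strictMono_arrival (hpos n)).lt_iff_lt.1
      ((show (W n).arrival i ≤ t from hi).trans_lt (hj n))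
  injective p q he := by
    by_cases h1 : p.1 = q.1
    · refine Prod.ext h1 ((strictMono_arrival (hpos q.1)).injective ?_)
      rw [← he, h1]
    · exact absurd he (hne p q fun h => absurd h h1).1
  departure_ne p q hpq := by
    by_cases h1 : p.1 = q.1
    · rcases lt_trichotomy p.2 q.2 with h2 | h2 | h2
      · have := strictMono_arrival (hpos q.1) h2
        have h3 := hnonneg q.1 q.2
        rw [h1]
        intro he
        linarith
      · exact absurd (Prod.ext h1 h2) hpq
      · exact (hne p q fun _ => h2).2.symm
    · exact (hne p q fun h => absurd h h1).2.symm

end Path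

/-! ### Independent variables without atoms almost surely do not coincide. -/

section Coincidence

variable {Ω ι : Type*} [MeasurableSpace Ω] {μ : Measure Ω} [IsProbabilityMeasure μ]

lemma ae_ne_of_indepFun {Y Z : Ω → ℝ} (hY : AEMeasurable Y μ) (hZ : AEMeasurable Z μ)
    (hYZ : IndepFun Y Z μ) [NullSingletonClass (μ.map Y)] : ∀ᵐ ω ∂μ, Y ω ≠ Z ω := by
  have hmap := (indepFun_iff_map_prod_eq_prod_map_map hZ hY).1 hYZ.symm
  have := Measure.isProbabilityMeasure_map (μ := μ) hY
  have := Measure.isProbabilityMeasure_map (μ := μ) hZ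
  have h : ∀ᵐ z ∂(μ.map Z).prod (μ.map Y), z.2 ≠ z.1 := by
    have hd : MeasurableSet {z : ℝ × ℝ | z.2 = z.1} :=
      measurableSet_eq_fun measurable_snd measurable_fst
    rw [ae_iff]
    simp only [ne_eq, not_not]
    rw [Measure.measure_prod_null hd]
    refine Eventually.of_forall fun a => ?_
    change μ.map Y {b | b = a} = 0
    exact measure_singleton a
  rw [← hmap] at h
  exact ae_of_ae_map (hZ.prodMk hY) h

/-- A member of an independent family without atoms almost surely differs from any function of
finitely many other members. -/
lemma ae_ne_of_iIndepFun {F : ι → Ω → ℝ} (hF : iIndepFun F μ) (hm : ∀ i, AEMeasurable (F i) μ)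
    {i : ι} {s : Finset ι} (hi : i ∉ s) [NullSingletonClass (μ.map (F i))] {Ψ : (ι → ℝ) → ℝ}
    (hΨ : Measurable Ψ) (hdep : ∀ u v : ι → ℝ, (∀ j ∈ s, u j = v j) → Ψ u = Ψ v) :
    ∀ᵐ ω ∂μ, F i ω ≠ Ψ fun j => F j ω := by
  classical
  -- Extension by 0 outside `s` makes `Ψ` a function of the coordinates in `s` alone; by `hdep` the
  -- filler is irrelevant.
  set ext : (s → ℝ) → ι → ℝ := fun v j => if h : j ∈ s then v ⟨j, h⟩ else 0 with hext
  have hextm : Measurable ext := by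
    refine measurable_pi_lambda _ fun j => ?_
    by_cases h : j ∈ s
    · simp only [hext, h, dif_pos]
      exact measurable_pi_apply _
    · simp only [hext, h, dif_neg, not_false_eq_true]
      exact measurable_const
  have hres : AEMeasurable (fun ω (j : s) => F j ω) μ := aemeasurable_pi_iff.2 fun j => hm j
  have heval : Measurable fun v : ({i} : Finset ι) → ℝ => v ⟨i, Finset.mem_singleton_self i⟩ :=
    measurable_pi_apply _
  have hind := (hF.indepFun_finset₀ {i} s (by simpa using hi) hm).comp heval (hΨ.comp hextm)
  have := ae_ne_of_indepFun (hm i) ((hΨ.comp hextm).comp_aemeasurable hres) hind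
  filter_upwards [this] with ω hω he
  refine hω (he.trans (hdep _ _ fun j hj => ?_))
  simp [hext, hj]

end Coincidence

/-! ### From the given random variables to the canonical input streams. -/

section Transfer

variable {Ω : Type*} [MeasurableSpace Ω] {μ : Measure Ω} {N : ℕ}
  {lam : Fin N → ℝ} {G : Fin N → Measure ℝ} {τ S : Fin N → ℕ → Ω → ℝ}

/-- Independence gives a product law over all inter-arrival and service times; it is regrouped first
into pairs and then into one stream per class. -/
lemma hasLaw_input_systemLaw (hlam : ∀ n, 0 < lam n) [∀ n, IsProbabilityMeasure (G n)]
    (hτ : ∀ n i, HasLaw (τ n i) (expMeasure (lam n)) μ)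
    (hS : ∀ n i, HasLaw (S n i) (G n) μ)
    (hindep : iIndepFun
      (Sum.elim (fun p : Fin N × ℕ => τ p.1 p.2) (fun p : Fin N × ℕ => S p.1 p.2)) μ) :
    HasLaw (fun ω n i => (τ n i ω, S n i ω)) (systemLaw lam G) μ := by
  have := fun n => isProbabilityMeasure_expMeasure (hlam n)
  set ν : (Fin N × ℕ) ⊕ (Fin N × ℕ) → Measure ℝ :=
    Sum.elim (fun p => expMeasure (lam p.1)) (fun p => G p.1) with hν
  have : ∀ j, IsProbabilityMeasure (ν j) := by
    rintro (p | p)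
    · exact isProbabilityMeasure_expMeasure (hlam p.1)
    · exact inferInstanceAs (IsProbabilityMeasure (G p.1))
  have hlaw : HasLaw (fun ω j => Sum.elim (fun p : Fin N × ℕ => τ p.1 p.2)
      (fun p : Fin N × ℕ => S p.1 p.2) j ω) (Measure.infinitePi ν) μ := by
    have hX : ∀ j, HasLaw (Sum.elim (fun p : Fin N × ℕ => τ p.1 p.2)
        (fun p : Fin N × ℕ => S p.1 p.2) j) (ν j) μ := by
      rintro (p | p)
      · exact hτ p.1 p.2
      · exact hS p.1 p.2
    exact hindep.hasLaw_infinitePi hX (aemeasurable_pi_iff.2 fun j => (hX j).aemeasurable)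
  have hpairs : MeasurePreserving
      (fun (u : (Fin N × ℕ) ⊕ (Fin N × ℕ) → ℝ) (p : Fin N × ℕ) => (u (Sum.inl p), u (Sum.inr p)))
      (Measure.infinitePi ν)
      (Measure.infinitePi fun p : Fin N × ℕ => (expMeasure (lam p.1)).prod (G p.1)) := by
    -- The Boolean selects the inter-arrival or the service time, so that currying the product
    -- groups the two coordinates of each packet.
    set f : (Fin N × ℕ) × Bool → (Fin N × ℕ) ⊕ (Fin N × ℕ) :=
      fun q => bif q.2 then Sum.inl q.1 else Sum.inr q.1 with hf
    have hinj : Function.Injective f := by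
      rintro ⟨p, b⟩ ⟨q, c⟩ h
      cases b <;> cases c <;> simp_all
    have hcur := Measure.infinitePi_map_curry fun (p : Fin N × ℕ) (b : Bool) => ν (f (p, b))
    have hpi := Measure.infinitePi_map_pi
      (μ := fun p : Fin N × ℕ => Measure.infinitePi fun b : Bool => ν (f (p, b)))
      (f := fun _ (y : Bool → ℝ) => (y true, y false)) fun _ => by fun_prop
    have hpair : ∀ p : Fin N × ℕ, (Measure.infinitePi fun b : Bool => ν (f (p, b))).map
        (fun y => (y true, y false)) = (expMeasure (lam p.1)).prod (G p.1) := fun p =>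
      Measure.infinitePi_map_eval_prod (P := fun b : Bool => ν (f (p, b))) (by simp)
    refine ⟨by fun_prop, ?_⟩
    simp only [hpair] at hpi
    rw [← hpi, ← hcur, ← Measure.map_infinitePi_infinitePi_of_inj (P := ν) hinj,
      Measure.map_map (MeasurableEquiv.measurable _) (by fun_prop),
      Measure.map_map (by fun_prop) ((MeasurableEquiv.measurable _).comp (by fun_prop))]
    rfl
  have hcurry : MeasurePreserving (MeasurableEquiv.curry (Fin N) ℕ (ℝ × ℝ))
      (Measure.infinitePi fun p : Fin N × ℕ => (expMeasure (lam p.1)).prod (G p.1))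
      (systemLaw lam G) := by
    refine ⟨MeasurableEquiv.measurable _, ?_⟩
    rw [Measure.infinitePi_map_curry fun (n : Fin N) (_ : ℕ) => (expMeasure (lam n)).prod (G n),
      Measure.infinitePi_eq_pi]
    rfl
  exact (hcurry.comp hpairs).comp_hasLaw hlaw

lemma ae_isRegularInput [IsProbabilityMeasure μ] (hlam : ∀ n, 0 < lam n)
    [∀ n, IsProbabilityMeasure (G n)]
    (hG : ∀ n, ∀ᵐ s ∂G n, 0 ≤ s)
    (hτ : ∀ n i, HasLaw (τ n i) (expMeasure (lam n)) μ)
    (hS : ∀ n i, HasLaw (S n i) (G n) μ)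
    (hindep : iIndepFun
      (Sum.elim (fun p : Fin N × ℕ => τ p.1 p.2) (fun p : Fin N × ℕ => S p.1 p.2)) μ) :
    ∀ᵐ ω ∂μ, IsRegularInput fun n i => (τ n i ω, S n i ω) := by
  classical
  have := fun n => isProbabilityMeasure_expMeasure (hlam n)
  have hlaw := hasLaw_input_systemLaw hlam hτ hS hindep
  have hstream : ∀ᵐ W ∂systemLaw lam G, ∀ n,
      (∀ i, 0 < (W n i).1) ∧ (∀ i, 0 ≤ (W n i).2) ∧ (W n).Unbounded := by
    rw [ae_all_iff]
    intro n
    have h : ∀ᵐ w ∂law ((expMeasure (lam n)).prod (G n)),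
        (∀ i, 0 < (w i).1) ∧ (∀ i, 0 ≤ (w i).2) ∧ w.Unbounded := by
      filter_upwards [ae_law_pos (G := G n) (hlam n), ae_law_snd_nonneg (hlam n) (hG n),
        ae_law_unbounded (G := G n) (hlam n)] with w h1 h2 h3
      exact ⟨h1, h2, h3⟩
    exact (Measure.quasiMeasurePreserving_eval
      (μ := fun n => law ((expMeasure (lam n)).prod (G n))) n).ae h
  rw [← hlaw.map_eq] at hstream
  have hm : ∀ j, AEMeasurable (Sum.elim (fun p : Fin N × ℕ => τ p.1 p.2)
      (fun p : Fin N × ℕ => S p.1 p.2) j) μ := by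
    rintro (p | p)
    · exact (hτ p.1 p.2).aemeasurable
    · exact (hS p.1 p.2).aemeasurable
  -- The choices ε = 0 and ε = 1 exclude coincidence with an arrival and with a departure. A
  -- coincidence would express the last inter-arrival time before `p` through finitely many other
  -- variables; the condition on `p` and `q` ensures that this time does not also enter the arrival
  -- time of `q`.
  have hne : ∀ (ε : ℝ) (p q : Fin N × ℕ), (p.1 = q.1 → q.2 < p.2) → ∀ᵐ ω ∂μ,
      arrivalTime (fun i => τ p.1 i ω) p.2 ≠
        arrivalTime (fun i => τ q.1 i ω) q.2 + ε * S q.1 q.2 ω := by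
    intro ε p q hpq
    set F : (Fin N × ℕ) ⊕ (Fin N × ℕ) → Ω → ℝ := Sum.elim (fun p : Fin N × ℕ => τ p.1 p.2)
      (fun p : Fin N × ℕ => S p.1 p.2) with hF
    have : NullSingletonClass (μ.map (F (Sum.inl p))) := by
      change NullSingletonClass (μ.map (τ p.1 p.2))
      rw [(hτ p.1 p.2).map_eq]
      infer_instance
    set s : Finset ((Fin N × ℕ) ⊕ (Fin N × ℕ)) :=
      ((Finset.univ ×ˢ Finset.range (p.2 + q.2 + 1)).disjSum
        (Finset.univ ×ˢ Finset.range (p.2 + q.2 + 1))).erase (Sum.inl p) with hs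
    set Ψ : ((Fin N × ℕ) ⊕ (Fin N × ℕ) → ℝ) → ℝ := fun u =>
      ∑ j ∈ Finset.range (q.2 + 1), u (Sum.inl (q.1, j)) + ε * u (Sum.inr q) -
        ∑ j ∈ Finset.range p.2, u (Sum.inl (p.1, j)) with hΨ
    have hΨm : Measurable Ψ := by fun_prop
    have hdep : ∀ u v : (Fin N × ℕ) ⊕ (Fin N × ℕ) → ℝ, (∀ j ∈ s, u j = v j) → Ψ u = Ψ v := by
      intro u v huv
      have h1 : ∀ j ∈ Finset.range (q.2 + 1), u (Sum.inl (q.1, j)) = v (Sum.inl (q.1, j)) := by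
        intro j hj
        rw [Finset.mem_range] at hj
        refine huv _ (Finset.mem_erase.2 ⟨fun he => ?_, ?_⟩)
        · have he' := Sum.inl.inj he
          have := hpq (by rw [← he'])
          have : j = p.2 := by rw [← he']
          omega
        · simp only [Finset.inl_mem_disjSum, Finset.mem_product, Finset.mem_univ, true_and,
            Finset.mem_range]
          omega
      have h2 : u (Sum.inr q) = v (Sum.inr q) := by
        refine huv _ (Finset.mem_erase.2 ⟨by simp, ?_⟩)
        simp only [Finset.inr_mem_disjSum, Finset.mem_product, Finset.mem_univ, true_and,
          Finset.mem_range]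
        omega
      have h3 : ∀ j ∈ Finset.range p.2, u (Sum.inl (p.1, j)) = v (Sum.inl (p.1, j)) := by
        intro j hj
        rw [Finset.mem_range] at hj
        refine huv _ (Finset.mem_erase.2 ⟨fun he => ?_, ?_⟩)
        · have : j = p.2 := by rw [← Sum.inl.inj he]
          omega
        · simp only [Finset.inl_mem_disjSum, Finset.mem_product, Finset.mem_univ, true_and,
            Finset.mem_range]
          omega
      simp only [hΨ]
      rw [Finset.sum_congr rfl h1, h2, Finset.sum_congr rfl h3]
    filter_upwards [ae_ne_of_iIndepFun hindep hm (i := Sum.inl p) (s := s) (by simp [hs]) hΨm hdep]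
      with ω hω he
    refine hω ?_
    simp only [arrivalTime, Finset.sum_range_succ _ p.2] at he
    simp only [hΨ, hF, Sum.elim_inl, Sum.elim_inr]
    linarith
  have hne0 : ∀ᵐ ω ∂μ, ∀ p q : Fin N × ℕ, (p.1 = q.1 → q.2 < p.2) →
      arrivalTime (fun i => τ p.1 i ω) p.2 ≠
        arrivalTime (fun i => τ q.1 i ω) q.2 + 0 * S q.1 q.2 ω := by
    simp only [ae_all_iff]
    exact fun p q hpq => hne 0 p q hpq
  have hne1 : ∀ᵐ ω ∂μ, ∀ p q : Fin N × ℕ, (p.1 = q.1 → q.2 < p.2) →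
      arrivalTime (fun i => τ p.1 i ω) p.2 ≠
        arrivalTime (fun i => τ q.1 i ω) q.2 + 1 * S q.1 q.2 ω := by
    simp only [ae_all_iff]
    exact fun p q hpq => hne 1 p q hpq
  filter_upwards [ae_of_ae_map hlaw.aemeasurable hstream, hne0, hne1] with ω h1 h2 h3
  refine isRegularInput_of (fun n => (h1 n).1) (fun n => (h1 n).2.1) (fun n => (h1 n).2.2)
    fun p q hpq => ⟨?_, ?_⟩
  · have := h2 p q hpq
    rw [zero_mul, add_zero] at this
    exact this
  · have := h3 p q hpq
    rw [one_mul] at this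
    exact this

end Transfer

end

end MG11

theorem mainTheorem2 {Ω : Type*} [MeasurableSpace Ω] (μ : Measure Ω) [IsProbabilityMeasure μ]
    (N : ℕ)
    -- arrival rates and service time distributions of the classes
    (lam : Fin N → ℝ) (hlam : ∀ n, 0 < lam n)
    (G : Fin N → Measure ℝ) (hG_nonneg : ∀ n, ∀ᵐ s ∂(G n), 0 ≤ s)
    (hG_mean : ∀ n, Integrable (fun s : ℝ => s) (G n))
    (x : Fin N → ℝ) (hx : ∀ n, x n = ∫ s, s ∂(G n))
    -- inter-arrival times and service times, all independent
    (τ S : Fin N → ℕ → Ω → ℝ)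
    (hτ : ∀ n i, HasLaw (τ n i) (expMeasure (lam n)) μ)
    (hS : ∀ n i, HasLaw (S n i) (G n) μ)
    (hindep : iIndepFun
      (Sum.elim (fun p : Fin N × ℕ => τ p.1 p.2) (fun p : Fin N × ℕ => S p.1 p.2)) μ)
    -- initial status ages
    (a₀ : Fin N → ℝ) (ha₀ : ∀ n, 0 ≤ a₀ n) :
    ∀ᵐ ω ∂μ,
      (∃! Adm : Set (Fin N × ℕ),
        MG11.IsAdmitted (fun n => MG11.arrivalTime (fun i => τ n i ω)) (fun n i => S n i ω) Adm) ∧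
      ∀ Adm : Set (Fin N × ℕ),
        MG11.IsAdmitted (fun n => MG11.arrivalTime (fun i => τ n i ω)) (fun n i => S n i ω) Adm →
        ∀ n : Fin N,
          MG11.HasPAoI (fun n => MG11.arrivalTime (fun i => τ n i ω)) (fun n i => S n i ω)
            Adm (a₀ n) n (x n + 1 / lam n + (∑ k, lam k * x k) / lam n) := by

  have hprob : ∀ n, IsProbabilityMeasure (G n) := fun n =>
    ((hS n 0).isProbabilityMeasure_iff).1 inferInstance
  have hreg := MG11.ae_isRegularInput hlam hG_nonneg hτ hS hindep
  cases N with
  -- Without classes there are no packets; the canonical construction needs at least one class.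
  | zero =>
    filter_upwards [] with ω
    refine ⟨⟨∅, fun p => p.1.elim0, fun A _ => Set.ext fun p => p.1.elim0⟩, fun _ _ n => n.elim0⟩
  | succ N =>
    have hlaw := MG11.hasLaw_input_systemLaw hlam hτ hS hindep
    have htrans : ∀ {Q : (Fin (N + 1) → MG11.PacketStream) → Prop},
        (∀ᵐ W ∂MG11.systemLaw lam G, Q W) → ∀ᵐ ω ∂μ, Q fun n i => (τ n i ω, S n i ω) := by
      intro Q hQ
      rw [← hlaw.map_eq] at hQ
      exact ae_of_ae_map hlaw.aemeasurable hQ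
    filter_upwards [hreg, htrans (MG11.tendsto_average_idle hlam hG_nonneg),
      htrans (MG11.tendsto_average_service hlam hG_nonneg hG_mean),
      ae_all_iff.2 fun n => htrans (MG11.tendsto_average_class hlam hG_nonneg n),
      ae_all_iff.2 fun n => htrans (MG11.tendsto_average_class_service hlam hG_nonneg hG_mean n)]
      with ω hω hidle hserv hclass hboth
    simp only [← hx] at hserv hboth
    have hadm := hω.isAdmissionSeq.isAdmitted hω
    refine ⟨⟨_, hadm, fun A hA => MG11.IsAdmitted.unique hω.finite_le hA hadm⟩, ?_⟩
    intro A hA n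
    rw [MG11.IsAdmitted.unique hω.finite_le hA hadm]
    exact hω.hasPAoI hlam hidle hserv (hclass n) (hboth n) (ha₀ n)
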